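/- Let $p$ be a prime, $N=\mathbb Z[1/p]^2$, $M=\mathbb Z^2$, $Q=\mathrm{GL}(2,\mathbb Z[1/p])$ and $R=\mathrm{GL}(2,\mathbb Z)$, with $Q$ acting on the column vectors $N$ by matrix multiplication; regard $R$ as a subgroup of $Q$, and put $G=N\rtimes Q$ and $H=M\rtimes R<G$. For $n\ge 0$ let $R(p^n)$ be the normal subgroup of those $r\in R$ with $r\equiv I \pmod{p^n}$. For a commutative ring $J$ let $\mathrm{SL}_\pm(2,J)$ be the group of $2\times 2$ matrices over $J$ with determinant $\pm1$, and write $\pm p^{\mathbb Z}=\{\pm p^k: k\in\mathbb Z\}$. A Hecke pair is a group with a subgroup each of whose double cosets is a finite union of left cosets; it is reduced if the intersection of the conjugates of the subgroup is trivial. A Schlichting pair is a reduced Hecke pair $(\mathcal G,\mathcal H)$ with $\mathcal G$ a locally compact Hausdorff group and $\mathcal H$ compact and open in $\mathcal G$. A Schlichting completion of a reduced Hecke pair $(G,H)$ is a Schlichting pair $(\mathcal G,\mathcal H)$ with a homomorphism $\sigma:G\to\mathcal G$ such that $\sigma(G)$ is dense and $H=\sigma^{-1}(\mathcal H)$. Then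 $(G,H)$ is a reduced Hecke pair and has a Schlichting completion. For every Schlichting completion $(\mathcal G,\mathcal H,\sigma)$ of $(G,H)$, let $\bar R$ and $\bar Q$ be the closures of $\sigma(R)$ and $\sigma(Q)$ in $\mathcal G$. Then: (i) $\bar R=\varprojlim_n R/R(p^n)=\mathrm{SL}_\pm(2,\mathbb Z_p)$, that is, there are isomorphisms of topological groups $\bar R\cong\varprojlim_n R/R(p^n)\cong\mathrm{SL}_\pm(2,\mathbb Z_p)$. The first sends $\sigma(r)$, for $r\in R$, to the family $(rR(p^n))_n$. The second sends a coherent family $(r_nR(p^n))_n$ to the matrix that is congruent to $r_n$ modulo $p^n$ for every $n$. (ii) $\bar Q=\bigcup_{q\in Q/R}q\,\mathrm{SL}_\pm(2,\mathbb Z_p)=\{g\in\mathrm{GL}(2,\mathbb Q_p):\det g\in\pm p^{\mathbb Z}\}$, where $\bar Q$ has the topology from $\bar R=\mathrm{SL}_\pm(2,\mathbb Z_p)$. That is, in $\mathcal G$ one has $\bar Q=\bigcup_{q\in Q/R}\sigma(q)\bar R$, and $\bar R$ is open in $\bar Q$; in $\mathrm{GL}(2,\mathbb Q_p)$ one has $\bigcup_{q\in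 Q/R}q\,\mathrm{SL}_\pm(2,\mathbb Z_p)=\{g:\det g\in\pm p^{\mathbb Z}\}$; and there is an isomorphism of topological groups from $\bar Q$ onto the latter group (with its topology as a subspace of $\mathrm{GL}(2,\mathbb Q_p)$) that sends $\sigma(q)$ to $q$ for all $q\in Q$ and extends the isomorphism $\bar R\cong\mathrm{SL}_\pm(2,\mathbb Z_p)$ of (i). -/

import Mathlib

open scoped MatrixGroups Pointwise

/-! Hecke pairs, Schlichting pairs and Schlichting completions. -/

/-- `(G, H)` is a Hecke pair: every double coset `H x H` is a finite union of left cosets of `H`. -/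
def IsHeckePair {G : Type*} [Group G] (H : Subgroup G) : Prop :=
  ∀ x : G, ((QuotientGroup.mk : G → G ⧸ H) '' ((H : Set G) * {x} * (H : Set G))).Finite

/-- `(G, H)` is reduced: the intersection of all conjugates of `H` is trivial. -/
def IsReducedPair {G : Type*} [Group G] (H : Subgroup G) : Prop :=
  ⨅ x : G, H.map (MulAut.conj x).toMonoidHom = ⊥

/-- `(L, K)` is a Schlichting pair: a reduced Hecke pair in which `L` is a locally compact
Hausdorff (topological) group and `K` is a compact open subgroup. -/
structure IsSchlichtingPair {L : Type*} [Group L] [TopologicalSpace L] [IsTopologicalGroup L]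
    (K : Subgroup L) : Prop where
  hecke : IsHeckePair K
  reduced : IsReducedPair K
  locallyCompact : LocallyCompactSpace L
  hausdorff : T2Space L
  isCompact : IsCompact (K : Set L)
  isOpen : IsOpen (K : Set L)

/-- `(L, K)`, together with the homomorphism `σ : G → L`, is a Schlichting completion of
the pair `(G, H)`: `(L, K)` is a Schlichting pair, `σ(G)` is dense in `L` and `H = σ⁻¹(K)`. -/
structure IsSchlichtingCompletion {G : Type*} [Group G] (H : Subgroup G)
    {L : Type*} [Group L] [TopologicalSpace L] [IsTopologicalGroup L]
    (σ : G →* L) (K : Subgroup L) : Prop where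
  pair : IsSchlichtingPair K
  dense : DenseRange σ
  comap_eq : H = K.comap σ

/-! The groups `N ⋊ Q` and `M ⋊ R`. -/

/-- The ring `ℤ[1/p]`, as a subring of `ℚ`. -/
abbrev ZInv (p : ℕ) : Subalgebra ℤ ℚ := Algebra.adjoin ℤ {(p : ℚ)⁻¹}

/-- The group `GL(2, J)` acting on the additive group `J²` of column vectors. -/
def glAction (J : Type*) [CommRing J] : GL (Fin 2) J →* MulAut (Multiplicative (Fin 2 → J)) where
  toFun g :=
    { toFun := fun v => Multiplicative.ofAdd ((g : Matrix (Fin 2) (Fin 2) J).mulVec v.toAdd)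
      invFun := fun v =>
        Multiplicative.ofAdd (((g⁻¹ : GL (Fin 2) J) : Matrix (Fin 2) (Fin 2) J).mulVec v.toAdd)
      left_inv := fun v => by
        simp only [toAdd_ofAdd, Matrix.mulVec_mulVec, Units.inv_mul, Matrix.one_mulVec, ofAdd_toAdd]
      right_inv := fun v => by
        simp only [toAdd_ofAdd, Matrix.mulVec_mulVec, Units.mul_inv, Matrix.one_mulVec, ofAdd_toAdd]
      map_mul' := fun v w => by
        simp only [toAdd_mul, Matrix.mulVec_add, ofAdd_add] }
  map_one' := by
    ext v : 1
    simp
  map_mul' g h := by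
    ext v : 1
    exact congrArg Multiplicative.ofAdd (Matrix.mulVec_mulVec v.toAdd _ _).symm

/-- The group `G = N ⋊ Q`, with `N = ℤ[1/p]²` and `Q = GL(2, ℤ[1/p])`. -/
abbrev AffG (p : ℕ) : Type :=
  Multiplicative (Fin 2 → ZInv p) ⋊[glAction (ZInv p)] GL (Fin 2) (ZInv p)

/-- The inclusion of `Q` into `G = N ⋊ Q`. -/
abbrev inQ (p : ℕ) : GL (Fin 2) (ZInv p) →* AffG p := SemidirectProduct.inr

/-- The inclusion of `GL(2, ℤ)` into `Q = GL(2, ℤ[1/p])`. -/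
abbrev intToQ (p : ℕ) : GL (Fin 2) ℤ →* GL (Fin 2) (ZInv p) :=
  Matrix.GeneralLinearGroup.map (Int.castRingHom (ZInv p))

/-- `R = GL(2, ℤ)`, as a subgroup of `Q`. -/
abbrev subR (p : ℕ) : Subgroup (GL (Fin 2) (ZInv p)) := (intToQ p).range

/-- `M = ℤ²`, as a subgroup of `N = ℤ[1/p]²`. -/
def subM (p : ℕ) : Subgroup (Multiplicative (Fin 2 → ZInv p)) where
  carrier := {v | ∃ m : Fin 2 → ℤ, ∀ i, v.toAdd i = (m i : ZInv p)}
  one_mem' := ⟨0, fun i => by simp⟩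
  mul_mem' := by
    rintro v w ⟨m, hm⟩ ⟨k, hk⟩
    exact ⟨m + k, fun i => by simp [hm, hk]⟩
  inv_mem' := by
    rintro v ⟨m, hm⟩
    exact ⟨-m, fun i => by simp [hm]⟩

theorem glAction_mem_subM (p : ℕ) {q : GL (Fin 2) (ZInv p)} (hq : q ∈ subR p)
    {v : Multiplicative (Fin 2 → ZInv p)} (hv : v ∈ subM p) :
    glAction (ZInv p) q v ∈ subM p := by
  obtain ⟨r, rfl⟩ := hq
  obtain ⟨m, hm⟩ := hv
  refine ⟨(r : Matrix (Fin 2) (Fin 2) ℤ).mulVec m, fun i => ?_⟩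
  fin_cases i <;> simp [glAction, Matrix.mulVec, dotProduct, hm]

/-- The subgroup `H = M R = M ⋊ R` of `G = N ⋊ Q`. -/
def subH (p : ℕ) : Subgroup (AffG p) where
  carrier := {g | g.left ∈ subM p ∧ g.right ∈ subR p}
  one_mem' := ⟨one_mem _, one_mem _⟩
  mul_mem' := by
    rintro a b ⟨ha, ha'⟩ ⟨hb, hb'⟩
    exact ⟨mul_mem ha (glAction_mem_subM p ha' hb), mul_mem ha' hb'⟩
  inv_mem' := by
    rintro a ⟨ha, ha'⟩
    exact ⟨glAction_mem_subM p (inv_mem ha') (inv_mem ha), inv_mem ha'⟩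

/-! The inverse limit of the groups `R / R(pⁿ)`. -/

/-- `R(pⁿ)`: the matrices in `R = GL(2, ℤ)` that are congruent to the identity modulo `pⁿ`
(see `mem_congR`). -/
def congR (p n : ℕ) : Subgroup (GL (Fin 2) ℤ) :=
  (Matrix.GeneralLinearGroup.map (n := Fin 2) (Int.castRingHom (ZMod (p ^ n)))).ker

instance congR_normal (p n : ℕ) : (congR p n).Normal :=
  inferInstanceAs ((Matrix.GeneralLinearGroup.map (n := Fin 2)
    (Int.castRingHom (ZMod (p ^ n)))).ker).Normal

theorem mem_congR (p n : ℕ) (r : GL (Fin 2) ℤ) :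
    r ∈ congR p n ↔
      ∀ i j, ((p : ℤ) ^ n) ∣ ((r : Matrix (Fin 2) (Fin 2) ℤ) - 1) i j := by
  have key : ∀ i j, (((r : Matrix (Fin 2) (Fin 2) ℤ) i j : ℤ) : ZMod (p ^ n)) =
      (1 : Matrix (Fin 2) (Fin 2) (ZMod (p ^ n))) i j ↔
      ((p : ℤ) ^ n) ∣ ((r : Matrix (Fin 2) (Fin 2) ℤ) - 1) i j := by
    intro i j
    have h := ZMod.intCast_zmod_eq_zero_iff_dvd
      (((r : Matrix (Fin 2) (Fin 2) ℤ) - 1) i j) (p ^ n)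
    push_cast at h
    rw [← h, Matrix.sub_apply, Matrix.one_apply, Matrix.one_apply]
    push_cast
    rw [sub_eq_zero]
  rw [congR, MonoidHom.mem_ker, Units.ext_iff, ← Matrix.ext_iff]
  exact forall_congr' fun i => forall_congr' fun j => key i j

theorem congR_anti (p : ℕ) {m n : ℕ} (h : m ≤ n) : congR p n ≤ congR p m := by
  intro r hr
  rw [mem_congR] at hr ⊢
  exact fun i j => (pow_dvd_pow (p : ℤ) h).trans (hr i j)

/-- The finite-level quotient `R / R(pⁿ)`; its topology (the quotient of the discrete topology
of `GL(2, ℤ)`) is discrete, see `quotR_discrete`. -/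
abbrev QuotR (p n : ℕ) : Type := GL (Fin 2) ℤ ⧸ congR p n

instance quotR_discrete (p n : ℕ) : DiscreteTopology (QuotR p n) := by
  have : DiscreteTopology (Matrix (Fin 2) (Fin 2) ℤ) :=
    inferInstanceAs (DiscreteTopology (Fin 2 → Fin 2 → ℤ))
  have : DiscreteTopology (GL (Fin 2) ℤ) :=
    inferInstanceAs (DiscreteTopology (Matrix (Fin 2) (Fin 2) ℤ)ˣ)
  refine discreteTopology_iff_forall_isOpen.2 fun s => ?_
  exact isOpen_coinduced.2 (isOpen_discrete _)

/-- The transition homomorphism `R / R(pⁿ) → R / R(pᵐ)` for `m ≤ n`. -/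
def transR (p : ℕ) {m n : ℕ} (h : m ≤ n) : QuotR p n →* QuotR p m :=
  QuotientGroup.map (congR p n) (congR p m) (MonoidHom.id _) (congR_anti p h)

/-- The inverse limit of the groups `R / R(pⁿ)`: the group of coherent families, topologized as
a subspace of the product of the discrete groups `R / R(pⁿ)`. -/
def invLimR (p : ℕ) : Subgroup (∀ n : ℕ, QuotR p n) where
  carrier := {x | ∀ (m n : ℕ) (h : m ≤ n), transR p h (x n) = x m}
  one_mem' := fun m n h => map_one _
  mul_mem' := by
    intro x y hx hy m n h
    rw [Pi.mul_apply, Pi.mul_apply, map_mul, hx m n h, hy m n h]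
  inv_mem' := by
    intro x hx m n h
    rw [Pi.inv_apply, Pi.inv_apply, map_inv, hx m n h]

/-! The `p`-adic matrix groups. -/

/-- `SL_±(2, J)`: the invertible matrices over `J` with determinant `1` or `-1`. -/
def SLpm (J : Type*) [CommRing J] : Subgroup (GL (Fin 2) J) where
  carrier := {g | Matrix.GeneralLinearGroup.det g = 1 ∨ Matrix.GeneralLinearGroup.det g = -1}
  one_mem' := Or.inl (map_one _)
  mul_mem' := by
    rintro a b (ha | ha) (hb | hb) <;> simp [ha, hb]
  inv_mem' := by
    rintro a (ha | ha) <;> simp [ha]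

/-- The group of all `g` in `GL(2, ℚ_p)` with determinant in `± p^ℤ`. -/
def detPM (p : ℕ) [Fact p.Prime] : Subgroup (GL (Fin 2) ℚ_[p]) where
  carrier := {g | ∃ k : ℤ, (g : Matrix (Fin 2) (Fin 2) ℚ_[p]).det = (p : ℚ_[p]) ^ k ∨
    (g : Matrix (Fin 2) (Fin 2) ℚ_[p]).det = -(p : ℚ_[p]) ^ k}
  one_mem' := ⟨0, Or.inl (by simp)⟩
  mul_mem' := by
    have hp : (p : ℚ_[p]) ≠ 0 := Nat.cast_ne_zero.2 (Fact.out : p.Prime).ne_zero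
    rintro a b ⟨k, hk⟩ ⟨l, hl⟩
    refine ⟨k + l, ?_⟩
    rcases hk with hk | hk <;> rcases hl with hl | hl <;> simp [hk, hl, zpow_add₀ hp]
  inv_mem' := by
    rintro a ⟨k, hk⟩
    refine ⟨-k, ?_⟩
    rcases hk with hk | hk <;> simp [hk, inv_neg]

/-- The inclusion of `Q = GL(2, ℤ[1/p])` into `GL(2, ℚ_p)`. -/
noncomputable def qToQp (p : ℕ) [Fact p.Prime] : GL (Fin 2) (ZInv p) →* GL (Fin 2) ℚ_[p] :=
  Matrix.GeneralLinearGroup.map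
    ((Rat.castHom ℚ_[p]).comp (ZInv p).val.toRingHom)

/-- The inclusion of `GL(2, ℤ_p)` into `GL(2, ℚ_p)`. -/
noncomputable def zpToQp (p : ℕ) [Fact p.Prime] : GL (Fin 2) ℤ_[p] →* GL (Fin 2) ℚ_[p] :=
  Matrix.GeneralLinearGroup.map PadicInt.Coe.ringHom

/-! Closures in a completion. -/

section Closures

variable {p : ℕ} {L : Type*} [Group L] [TopologicalSpace L] [IsTopologicalGroup L]

/-- The closure of `R` in `L`. -/
def barR (σ : AffG p →* L) : Subgroup L :=
  ((subR p).map (σ.comp (inQ p))).topologicalClosure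

/-- The closure of `Q` in `L`. -/
def barQ (σ : AffG p →* L) : Subgroup L :=
  (σ.comp (inQ p)).range.topologicalClosure

end Closures

/-! ### Completions determined by the topology induced on a dense subgroup -/

section DenseHomomorphisms

open Filter Topology

variable {Q A B : Type*} [Group Q] [Group A] [TopologicalSpace A]
  [Group B] [TopologicalSpace B]

/-! A locally compact Hausdorff group containing a dense image of `Q` is determined by the group
topology that it induces on `Q` (`exists_continuousMulEquiv_of_denseRange`). So the closures can be
identified by comparing filters of neighbourhoods of 1, without constructing the completion.

The key fact is that every Schlichting completion induces the `p`-adic topology on `Q`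
(`IsSchlichtingCompletion.comap_nhds_one_inQ`). By compactness, its neighbourhoods of 1 are governed
by finitely many conjugates of `K`, which pull back to conjugates of `H`. Membership of `q` in a
conjugate of `H` is a `p`-adically open condition, because `H` is the integral part of `G` inside
`GL(3, ℚ_p)`. Conversely, conjugating by the translations `p⁻ⁿ eⱼ` cuts `R` down to `R(pⁿ)`.

On the `p`-adic side, transvections and determinants show that `Q` is dense in the matrices of
determinant in `± p^ℤ` (`detPM_le_topologicalClosure`). Since `GL(2, ℤ_p)` is open and meets `Q` in
`R`, density of `R` in `SL_±(2, ℤ_p)` follows. The inverse limit induces the same congruence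
topology on `R`.

Existence, the Hecke property and reducedness come from a concrete model: the closure of `G` in
`GL(3, ℚ_p)`, with its integral matrices as compact open subgroup. -/

theorem denseRange_codRestrict_of_closure {S : Subgroup A} (σ : Q →* S)
    (h : (S : Set A) ⊆ closure (Set.range fun q => (σ q : A))) : DenseRange σ := by
  intro x
  rw [closure_subtype, ← Set.range_comp]
  exact h x.2

theorem comap_nhds_one_codRestrict {S : Subgroup A} (σ : Q →* S) :
    comap σ (𝓝 1) = comap (fun q => (σ q : A)) (𝓝 1) := by
  rw [nhds_subtype, comap_comap]
  rfl

variable [IsTopologicalGroup A] [IsTopologicalGroup B]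

/-- A homomorphism into a locally compact Hausdorff group that is continuous for the group topology
pulled back along a dense homomorphism `σ` extends continuously along `σ`. -/
theorem exists_continuousMonoidHom_extend [T2Space B] [LocallyCompactSpace B]
    (σ : Q →* A) (τ : Q →* B) (hσ : DenseRange σ) (h : comap σ (𝓝 1) ≤ comap τ (𝓝 1)) :
    ∃ f : A →ₜ* B, ∀ q, f (σ q) = τ q := by
  let : TopologicalSpace Q := TopologicalSpace.induced σ inferInstance
  have di : IsDenseInducing σ := ⟨⟨rfl⟩, hσ⟩
  let := IsTopologicalGroup.rightUniformSpace B
  have : IsRightUniformGroup B := ⟨rfl⟩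
  have : CompleteSpace B := IsRightUniformGroup.completeSpace_of_weaklyLocallyCompactSpace
  -- Completeness of `B` reduces this to a Cauchy condition: if `σ x` and `σ y` are both close to
  -- `a`, then `σ (y * x⁻¹)` is close to 1, and hence so is `τ (y * x⁻¹)`.
  have lim : ∀ a, ∃ c, Tendsto τ (comap σ (𝓝 a)) (𝓝 c) := by
    intro a
    have := di.comap_nhds_neBot a
    apply CompleteSpace.complete (f := map τ (comap σ (𝓝 a)))
    rw [cauchy_map_iff]
    refine ⟨inferInstance, ?_⟩
    rw [uniformity_eq_comap_nhds_one' B, tendsto_comap_iff]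
    have h1 : Tendsto (fun x : Q × Q => x.2 * x.1⁻¹) (comap σ (𝓝 a) ×ˢ comap σ (𝓝 a))
        (comap σ (𝓝 1)) := by
      rw [tendsto_comap_iff]
      have h2 : Tendsto (fun x : A × A => x.2 * x.1⁻¹) (𝓝 a ×ˢ 𝓝 a) (𝓝 1) := by
        rw [← nhds_prod_eq]
        have : Continuous (fun x : A × A => x.2 * x.1⁻¹) := by fun_prop
        simpa using this.tendsto (a, a)
      have h3 : Tendsto σ (comap σ (𝓝 a)) (𝓝 a) := tendsto_comap
      refine (h2.comp (h3.prodMap h3)).congr fun x => ?_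
      simp
    refine (tendsto_comap.comp (h1.mono_right h)).congr fun x => ?_
    simp
  have hc : Continuous (di.extend τ) := di.continuous_extend lim
  have he : ∀ q, di.extend τ (σ q) = τ q := di.extend_eq' lim
  refine ⟨⟨MonoidHom.mk' (di.extend τ) fun a b => ?_, hc⟩, he⟩
  refine hσ.induction_on₂ (p := fun a b => di.extend τ (a * b) = di.extend τ a * di.extend τ b)
    ?_ ?_ a b
  · exact isClosed_eq (hc.comp continuous_mul)
      ((hc.comp continuous_fst).mul (hc.comp continuous_snd))
  · intro x y
    rw [← map_mul, he, he, he, map_mul]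

/-- Two locally compact Hausdorff groups with dense homomorphisms from the same group that induce
the same group topology are canonically isomorphic. -/
theorem exists_continuousMulEquiv_of_denseRange [T2Space A] [LocallyCompactSpace A] [T2Space B]
    [LocallyCompactSpace B] (σ : Q →* A) (τ : Q →* B) (hσ : DenseRange σ) (hτ : DenseRange τ)
    (h : comap σ (𝓝 1) = comap τ (𝓝 1)) :
    ∃ e : A ≃ₜ* B, ∀ q, e (σ q) = τ q := by
  obtain ⟨f, hf⟩ := exists_continuousMonoidHom_extend σ τ hσ h.le
  obtain ⟨g, hg⟩ := exists_continuousMonoidHom_extend τ σ hτ h.ge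
  have hgf : ∀ a, g (f a) = a := fun a =>
    hσ.induction_on (p := fun a => g (f a) = a) a
      (isClosed_eq (g.continuous.comp f.continuous) continuous_id) fun q => by rw [hf, hg]
  have hfg : ∀ b, f (g b) = b := fun b =>
    hτ.induction_on (p := fun b => f (g b) = b) b
      (isClosed_eq (f.continuous.comp g.continuous) continuous_id) fun q => by rw [hg, hf]
  exact ⟨{ toFun := f, invFun := g, left_inv := hgf, right_inv := hfg, map_mul' := map_mul f,
           continuous_toFun := f.continuous, continuous_invFun := g.continuous }, hf⟩

/-- A homomorphism into a topological group, with codomain restricted to the closure of its range. -/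
def toClosureRange (σ : Q →* A) : Q →* σ.range.topologicalClosure :=
  σ.codRestrict _ fun q => Subgroup.le_topologicalClosure _ ⟨q, rfl⟩

theorem denseRange_toClosureRange (σ : Q →* A) : DenseRange (toClosureRange σ) :=
  denseRange_codRestrict_of_closure _ fun _ hx => hx

end DenseHomomorphisms

/-! ### Hecke pairs and reduced pairs -/

section HeckePairs

open Filter Topology

/-- A compact open subgroup forms a Hecke pair with the whole group. -/
theorem isHeckePair_of_isCompact_isOpen {L : Type*} [Group L] [TopologicalSpace L]
    [IsTopologicalGroup L] {K : Subgroup L} (hc : IsCompact (K : Set L)) (ho : IsOpen (K : Set L)) :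
    IsHeckePair K := by
  intro x
  have : DiscreteTopology (L ⧸ K) := QuotientGroup.discreteTopology ho
  exact ((hc.mul isCompact_singleton).mul hc |>.image continuous_quotient_mk').finite_of_discrete

/-- The preimage of a Hecke pair is a Hecke pair. -/
theorem IsHeckePair.comap {G L : Type*} [Group G] [Group L] {K : Subgroup L} (hK : IsHeckePair K)
    (σ : G →* L) : IsHeckePair (K.comap σ) := by
  intro x
  let f : G ⧸ K.comap σ → L ⧸ K := Quotient.map' σ fun a b hab => by
    rw [QuotientGroup.leftRel_apply] at hab ⊢
    simpa using hab
  have hf : Function.Injective f := by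
    rintro ⟨a⟩ ⟨b⟩ hab
    have := QuotientGroup.eq.1 hab
    exact QuotientGroup.eq.2 (by simpa using this)
  refine Set.Finite.of_finite_image ((hK (σ x)).subset ?_) hf.injOn
  rintro _ ⟨_, ⟨_, ⟨_, ⟨h, hh, y, rfl, rfl⟩, k, hk, rfl⟩, rfl⟩, rfl⟩
  exact ⟨σ (h * y * k), ⟨σ h * σ y, ⟨σ h, hh, σ y, rfl, rfl⟩, σ k, hk, by simp⟩, rfl⟩

theorem isReducedPair_iff {G : Type*} [Group G] {H : Subgroup G} :
    IsReducedPair H ↔ ∀ g : G, (∀ x : G, x⁻¹ * g * x ∈ H) → g = 1 := by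
  have key : ∀ g x : G, g ∈ H.map (MulAut.conj x).toMonoidHom ↔ x⁻¹ * g * x ∈ H := by
    intro g x
    constructor
    · rintro ⟨h, hh, rfl⟩
      simpa [mul_assoc] using hh
    · intro hg
      exact ⟨_, hg, by simp [mul_assoc]⟩
  simp only [IsReducedPair, Subgroup.eq_bot_iff_forall, Subgroup.mem_iInf, key]

end HeckePairs

/-! ### Neighbourhoods of the identity in a Schlichting completion -/

namespace IsSchlichtingCompletion

open Filter Topology

variable {G : Type*} [Group G] {H : Subgroup G} {L : Type*} [Group L] [TopologicalSpace L]
  [IsTopologicalGroup L] {σ : G →* L} {K : Subgroup L}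

theorem mem_iff (hK : IsSchlichtingCompletion H σ K) (g : G) : σ g ∈ K ↔ g ∈ H := by
  rw [hK.comap_eq, Subgroup.mem_comap]

/-- In a Schlichting completion the conjugates of `K` by elements of `G` have trivial
intersection. -/
theorem eq_one_of_forall_conj_mem (hK : IsSchlichtingCompletion H σ K) {l : L}
    (hl : ∀ g : G, (σ g)⁻¹ * l * σ g ∈ K) : l = 1 := by
  refine isReducedPair_iff.1 hK.pair.reduced l fun x => ?_
  -- The conjugate of `K` by `x` depends only on the open coset `xK`, which contains some `σ g` by
  -- density.
  obtain ⟨g, k, hk, hg⟩ := hK.dense.exists_mem_open (hK.pair.isOpen.leftCoset x) ⟨x, 1, K.one_mem, by simp⟩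
  have hx : x = σ g * k⁻¹ := by simp [← hg]
  have := K.mul_mem (K.mul_mem hk (hl g)) (K.inv_mem hk)
  simpa [hx, mul_assoc] using this

/-- In a Schlichting completion, the finite intersections of the conjugates of `K` by elements of
`G` form a neighbourhood base at the identity. -/
theorem exists_finset_of_mem_nhds_one (hK : IsSchlichtingCompletion H σ K) {V : Set L}
    (hV : V ∈ 𝓝 (1 : L)) :
    ∃ F : Finset G, ∀ l : L, l ∈ K → (∀ g ∈ F, (σ g)⁻¹ * l * σ g ∈ K) → l ∈ V := by
  have := hK.pair.hausdorff
  obtain ⟨U, hUV, hU, h1⟩ := mem_nhds_iff.1 hV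
  -- The conjugates of `K` are closed and have trivial intersection, so they have no common point in
  -- the compact set `K \ U`; finitely many of them already have none.
  obtain ⟨F, hF⟩ := (hK.pair.isCompact.diff hU).elim_finite_subfamily_closed
    (fun g : G => {l : L | (σ g)⁻¹ * l * σ g ∈ K})
    (fun g => (Subgroup.isClosed_of_isOpen K hK.pair.isOpen).preimage (by fun_prop)) (by
      rw [Set.eq_empty_iff_forall_notMem]
      rintro l ⟨⟨-, hl⟩, h⟩
      rw [hK.eq_one_of_forall_conj_mem (l := l) (by simpa using h)] at hl
      exact hl h1)
  refine ⟨F, fun l hl h => hUV ?_⟩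
  by_contra hlU
  exact Set.eq_empty_iff_forall_notMem.1 hF l ⟨⟨hl, hlU⟩, by simpa using h⟩

end IsSchlichtingCompletion

/-! ### Arithmetic of `ℤ[1/p]` -/

section ZInv

variable {p : ℕ}

theorem ZInv.exists_mul_pow_eq_intCast (hp : p ≠ 0) (a : ZInv p) :
    ∃ (k : ℕ) (m : ℤ), (a : ℚ) * (p : ℚ) ^ k = m := by
  have hp' : (p : ℚ) ≠ 0 := Nat.cast_ne_zero.2 hp
  obtain ⟨a, ha⟩ := a
  induction ha using Algebra.adjoin_induction with
  | mem x hx =>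
    rw [Set.mem_singleton_iff] at hx
    exact ⟨1, 1, by simp [hx, hp']⟩
  | algebraMap r => exact ⟨0, r, by simp⟩
  | add x y _ _ hx hy =>
    obtain ⟨k, m, hm⟩ := hx
    obtain ⟨l, n, hn⟩ := hy
    simp only at hm hn ⊢
    refine ⟨k + l, m * p ^ l + n * p ^ k, ?_⟩
    push_cast
    rw [← hm, ← hn]
    ring
  | mul x y _ _ hx hy =>
    obtain ⟨k, m, hm⟩ := hx
    obtain ⟨l, n, hn⟩ := hy
    simp only at hm hn ⊢
    refine ⟨k + l, m * n, ?_⟩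
    push_cast
    rw [← hm, ← hn]
    ring

variable [hp : Fact p.Prime]

/-- The unit `p` of `ℤ[1/p]`. -/
def ZInv.unitP (p : ℕ) [hp : Fact p.Prime] : (ZInv p)ˣ where
  val := p
  inv := ⟨(p : ℚ)⁻¹, Algebra.subset_adjoin rfl⟩
  val_inv := Subtype.ext (mul_inv_cancel₀ (Nat.cast_ne_zero.2 hp.out.ne_zero))
  inv_val := Subtype.ext (inv_mul_cancel₀ (Nat.cast_ne_zero.2 hp.out.ne_zero))

theorem ZInv.coe_unitP_zpow (k : ℤ) : (((ZInv.unitP p ^ k : (ZInv p)ˣ) : ZInv p) : ℚ) = (p : ℚ) ^ k := by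
  have h := map_zpow (Units.map (ZInv p).val.toRingHom.toMonoidHom) (ZInv.unitP p) k
  have h' := congrArg Units.val h
  rw [Units.val_zpow_eq_zpow_val] at h'
  exact h'

/-- Clearing denominators in `u` and in `u⁻¹` gives integers whose product is a power of `p`; each
is then a power of `p` up to sign. -/
theorem ZInv.exists_zpow_of_unit (u : (ZInv p)ˣ) :
    ∃ k : ℤ, ((u : ZInv p) : ℚ) = (p : ℚ) ^ k ∨ ((u : ZInv p) : ℚ) = -(p : ℚ) ^ k := by
  have hp' : (p : ℚ) ≠ 0 := Nat.cast_ne_zero.2 hp.out.ne_zero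
  obtain ⟨k, m, hm⟩ := ZInv.exists_mul_pow_eq_intCast hp.out.ne_zero (u : ZInv p)
  obtain ⟨l, n, hn⟩ := ZInv.exists_mul_pow_eq_intCast hp.out.ne_zero ((u⁻¹ : (ZInv p)ˣ) : ZInv p)
  have huu : ((u : ZInv p) : ℚ) * (((u⁻¹ : (ZInv p)ˣ) : ZInv p) : ℚ) = 1 :=
    congrArg Subtype.val u.mul_inv
  have hmn : m * n = (p : ℤ) ^ (k + l) := by
    have : (m : ℚ) * n = (p : ℚ) ^ (k + l) := by
      rw [← hm, ← hn, pow_add]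
      linear_combination ((p : ℚ) ^ k * p ^ l) * huu
    exact_mod_cast this
  have hdvd : m.natAbs ∣ p ^ (k + l) := by
    rw [← Int.natCast_dvd_natCast]
    push_cast
    rw [abs_dvd]
    exact ⟨n, hmn.symm⟩
  obtain ⟨i, -, hi⟩ := (Nat.dvd_prime_pow hp.out).1 hdvd
  refine ⟨i - k, ?_⟩
  rw [zpow_sub₀ hp', ← neg_div, eq_div_iff (by positivity), eq_div_iff (by positivity)]
  simp only [zpow_natCast]
  rw [hm]
  rcases Int.natAbs_eq m with h | h
  · left; rw [h, hi]; push_cast; rfl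
  · right; rw [h, hi]; push_cast; rfl

/-- The inclusion of `ℤ[1/p]` into `ℚ_p`. -/
noncomputable def ZInv.toPadic (p : ℕ) [Fact p.Prime] : ZInv p →+* ℚ_[p] :=
  (Rat.castHom ℚ_[p]).comp (ZInv p).val.toRingHom

theorem ZInv.toPadic_apply (a : ZInv p) : ZInv.toPadic p a = ((a : ℚ) : ℚ_[p]) := rfl

theorem ZInv.toPadic_injective : Function.Injective (ZInv.toPadic p) :=
  fun _ _ h => Subtype.ext ((Rat.castHom ℚ_[p]).injective h)

/-- The only possible denominators are powers of `p`, and the norm bound makes `p ^ k` divide the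
numerator. All comparisons of integral with `p`-adically integral matrices rest on this. -/
theorem ZInv.exists_intCast_of_norm_le_one (a : ZInv p) (ha : ‖ZInv.toPadic p a‖ ≤ 1) :
    ∃ m : ℤ, a = m := by
  have hp' : (p : ℚ) ≠ 0 := Nat.cast_ne_zero.2 hp.out.ne_zero
  obtain ⟨k, m, hm⟩ := ZInv.exists_mul_pow_eq_intCast hp.out.ne_zero a
  have hm' : ZInv.toPadic p a * (p : ℚ_[p]) ^ k = m := by
    have := congrArg (Rat.cast : ℚ → ℚ_[p]) hm
    rw [ZInv.toPadic_apply]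
    exact_mod_cast this
  have hd : ((p ^ k : ℕ) : ℤ) ∣ m := by
    push_cast
    rw [← Padic.norm_int_le_pow_iff_dvd, ← hm', norm_mul, norm_pow, Padic.norm_p, inv_pow,
      zpow_neg, zpow_natCast]
    exact mul_le_of_le_one_left (by positivity) ha
  obtain ⟨n, rfl⟩ := hd
  refine ⟨n, Subtype.ext ?_⟩
  push_cast at hm ⊢
  rw [mul_comm] at hm
  exact mul_left_cancel₀ (pow_ne_zero k hp') hm

end ZInv

/-! ### Topology and integrality in `p`-adic general linear groups -/

section GeneralLinear

open Filter Topology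

variable {p : ℕ} [hp : Fact p.Prime] {n : Type*} [Fintype n] [DecidableEq n]

theorem isOpenEmbedding_generalLinearGroup_map {R S : Type*} [CommRing R] [TopologicalSpace R]
    [CommRing S] [TopologicalSpace S] {f : R →+* S} (hf : IsOpenEmbedding f) :
    IsOpenEmbedding (Matrix.GeneralLinearGroup.map (n := n) f) := by
  refine .of_isEmbedding_isOpenMap hf.isEmbedding.generalLinearGroup_map ?_
  refine Units.isOpenMap_map ?_ ?_
  · intro A B h
    ext i j
    exact hf.injective (congrFun (congrFun h i) j)
  · exact IsOpenMap.piMap (fun _ => IsOpenMap.piMap (fun _ => hf.isOpenMap) (by simp)) (by simp)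

theorem isOpenEmbedding_map_padicInt :
    IsOpenEmbedding (Matrix.GeneralLinearGroup.map (n := n) (PadicInt.Coe.ringHom (p := p))) :=
  isOpenEmbedding_generalLinearGroup_map PadicInt.isOpenEmbedding_coe

instance : CompactSpace (GL n ℤ_[p]) :=
  have : CompactSpace (Matrix n n ℤ_[p]) := inferInstanceAs (CompactSpace (n → n → ℤ_[p]))
  inferInstanceAs (CompactSpace (Matrix n n ℤ_[p])ˣ)

instance : LocallyCompactSpace (GL n ℚ_[p]) :=
  have : LocallyCompactSpace (Matrix n n ℚ_[p]) :=
    inferInstanceAs (LocallyCompactSpace (n → n → ℚ_[p]))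
  inferInstanceAs (LocallyCompactSpace (Matrix n n ℚ_[p])ˣ)

/-- An invertible matrix lies in `GL(n, R)`, for a subring `R`, if it and its inverse have entries
in `R`. -/
theorem exists_generalLinearGroup_map_eq {R S : Type*} [CommRing R] [CommRing S] {f : R →+* S}
    (hf : Function.Injective f) (g : GL n S) (A B : Matrix n n R)
    (hA : f.mapMatrix A = (g : Matrix n n S)) (hB : f.mapMatrix B = ((g⁻¹ : GL n S) : Matrix n n S)) :
    ∃ k : GL n R, Matrix.GeneralLinearGroup.map f k = g := by
  have hinj : Function.Injective (f.mapMatrix (m := n)) := Matrix.map_injective hf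
  exact ⟨⟨A, B, hinj (by rw [map_mul, hA, hB, map_one, Units.mul_inv]),
    hinj (by rw [map_mul, hA, hB, map_one, Units.inv_mul])⟩, Units.ext hA⟩

theorem exists_map_padicInt_eq (g : GL n ℚ_[p]) (h : ∀ i j, ‖g i j‖ ≤ 1)
    (h' : ∀ i j, ‖(g⁻¹ : GL n ℚ_[p]) i j‖ ≤ 1) :
    ∃ k : GL n ℤ_[p], Matrix.GeneralLinearGroup.map PadicInt.Coe.ringHom k = g :=
  exists_generalLinearGroup_map_eq Subtype.coe_injective g (.of fun i j => ⟨g i j, h i j⟩)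
    (.of fun i j => ⟨(g⁻¹ : GL n ℚ_[p]) i j, h' i j⟩) rfl rfl

/-- The congruence subgroups form a neighbourhood base at the identity of `GL(n, ℤ_p)`. -/
theorem hasBasis_nhds_one_padicInt :
    (𝓝 (1 : GL n ℤ_[p])).HasBasis (fun _ : ℕ => True) fun k =>
      {g | ∀ i j, (p : ℤ_[p]) ^ k ∣ ((g : Matrix n n ℤ_[p]) - 1) i j} := by
  -- Since `GL(n, ℤ_p)` is compact, its topology is that of the matrix entries alone; the inverse
  -- matrix need not be controlled.
  have he : IsClosedEmbedding (Units.val : GL n ℤ_[p] → Matrix n n ℤ_[p]) :=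
    Units.continuous_val.isClosedEmbedding Units.val_injective
  have h0 : (0 : ℝ) < (p : ℝ)⁻¹ := inv_pos.2 (Nat.cast_pos.2 hp.out.pos)
  have h1 : (p : ℝ)⁻¹ < 1 := inv_lt_one_of_one_lt₀ (Nat.one_lt_cast.2 hp.out.one_lt)
  have hb := Metric.nhds_basis_closedBall_pow (x := fun i j => (1 : Matrix n n ℤ_[p]) i j) h0 h1
  rw [he.isInducing.nhds_eq_comap]
  refine (hb.comap fun g : GL n ℤ_[p] => (g : Matrix n n ℤ_[p])).congr (fun _ => Iff.rfl) fun k _ => ?_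
  ext g
  change dist (fun i j => (g : Matrix n n ℤ_[p]) i j) (fun i j => (1 : Matrix n n ℤ_[p]) i j) ≤ _ ↔
    ∀ i j, (p : ℤ_[p]) ^ k ∣ (g : Matrix n n ℤ_[p]) i j - (1 : Matrix n n ℤ_[p]) i j
  rw [dist_pi_le_iff (by positivity)]
  refine forall_congr' fun i => (dist_pi_le_iff (by positivity)).trans <| forall_congr' fun j => ?_
  rw [dist_eq_norm, inv_pow, ← zpow_natCast, ← zpow_neg, PadicInt.norm_le_pow_iff_mem_span_pow,
    Ideal.mem_span_singleton]

/-- Reduction of integral matrices to `GL(n, ℤ_p)`. -/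
noncomputable def intToZp (p : ℕ) [Fact p.Prime] : GL (Fin 2) ℤ →* GL (Fin 2) ℤ_[p] :=
  Matrix.GeneralLinearGroup.map (Int.castRingHom ℤ_[p])

/-- Divisibility of an integer by `p ^ k` is the same in `ℤ` and in `ℤ_p`, so `R` receives its
congruence topology. -/
theorem hasBasis_comap_intToZp :
    (comap (intToZp p) (𝓝 1)).HasBasis (fun _ : ℕ => True) fun k => (congR p k : Set _) := by
  refine (hasBasis_nhds_one_padicInt.comap (intToZp p)).congr (fun _ => Iff.rfl) fun k _ => ?_
  ext r
  rw [SetLike.mem_coe, mem_congR]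
  refine forall_congr' fun i => forall_congr' fun j => ?_
  rw [← PadicInt.pow_p_dvd_int_iff]
  by_cases hij : i = j <;> simp [intToZp, hij]

theorem zpToQp_intToZp (r : GL (Fin 2) ℤ) : zpToQp p (intToZp p r) = qToQp p (intToQ p r) := by
  ext i j
  simp [zpToQp, intToZp, qToQp]

theorem qToQp_apply (q : GL (Fin 2) (ZInv p)) (i j : Fin 2) :
    qToQp p q i j = ZInv.toPadic p (q i j) := rfl

theorem qToQp_injective : Function.Injective (qToQp p) := by
  intro a b h
  ext i j
  exact congrArg Subtype.val (ZInv.toPadic_injective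
    (congrArg (fun g : GL (Fin 2) ℚ_[p] => g i j) h))

/-- `GL(2, ℤ[1/p]) ∩ GL(2, ℤ_p) = GL(2, ℤ)`. -/
theorem mem_subR_of_qToQp_eq {q : GL (Fin 2) (ZInv p)} {g : GL (Fin 2) ℤ_[p]}
    (h : qToQp p q = zpToQp p g) : ∃ r, intToQ p r = q ∧ intToZp p r = g := by
  have key : ∀ (q : GL (Fin 2) (ZInv p)) (g : GL (Fin 2) ℤ_[p]), qToQp p q = zpToQp p g →
      ∃ A : Matrix (Fin 2) (Fin 2) ℤ, (q : Matrix (Fin 2) (Fin 2) (ZInv p)) =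
        A.map (Int.castRingHom (ZInv p)) := by
    intro q g h
    have : ∀ i j, ∃ m : ℤ, q i j = m := fun i j => ZInv.exists_intCast_of_norm_le_one _ (by
      rw [← qToQp_apply, h]
      exact (g i j).2)
    choose A hA using this
    exact ⟨.of A, by ext i j; simp [hA]⟩
  obtain ⟨A, hA⟩ := key q g h
  obtain ⟨B, hB⟩ := key q⁻¹ g⁻¹ (by rw [map_inv, map_inv, h])
  obtain ⟨r, hr⟩ := exists_generalLinearGroup_map_eq (RingHom.injective_int _) q A B hA.symm hB.symm
  refine ⟨r, hr, isOpenEmbedding_map_padicInt.injective ?_⟩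
  change zpToQp p _ = zpToQp p g
  rw [zpToQp_intToZp, ← h]
  exact congrArg _ hr

end GeneralLinear

/-! ### Generation of `SL(2)` over a field by transvections -/

section FieldGeneration

open Matrix.GeneralLinearGroup

/-- The permutation matrix that exchanges the two coordinates. -/
def swapGL (R : Type*) [CommRing R] : GL (Fin 2) R where
  val := !![0, 1; 1, 0]
  inv := !![0, 1; 1, 0]
  val_inv := by simp [Matrix.one_fin_two]
  inv_val := by simp [Matrix.one_fin_two]

/-- The diagonal matrix with entries `u` and `1`. -/
def diagGL {R : Type*} [CommRing R] (u : Rˣ) : GL (Fin 2) R where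
  val := !![(u : R), 0; 0, 1]
  inv := !![((u⁻¹ : Rˣ) : R), 0; 0, 1]
  val_inv := by simp [Matrix.one_fin_two]
  inv_val := by simp [Matrix.one_fin_two]

theorem det_diagGL {R : Type*} [CommRing R] (u : Rˣ) : det (diagGL u) = u := by
  ext
  simp [diagGL]

/-- Over a field, a matrix of determinant `1` is a product of transvections. -/
theorem mem_of_upperRightHom_mem_of_swapGL_mem {F : Type*} [Field F] {C : Subgroup (GL (Fin 2) F)}
    (hu : ∀ x : F, upperRightHom x ∈ C) (hw : swapGL F ∈ C) {g : GL (Fin 2) F}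
    (hg : (g : Matrix (Fin 2) (Fin 2) F).det = 1) : g ∈ C := by
  have hl : ∀ x : F, swapGL F * upperRightHom x * swapGL F ∈ C :=
    fun x => C.mul_mem (C.mul_mem hw (hu x)) hw
  have main : ∀ g : GL (Fin 2) F, (g : Matrix (Fin 2) (Fin 2) F).det = 1 →
      g 1 0 ≠ 0 → g ∈ C := by
    intro g hg hc
    rw [Matrix.det_fin_two] at hg
    -- Conjugation by the swap makes the middle factor a lower transvection with the same lower left
    -- entry as `g`. The outer factors are then forced by the diagonal of `g`, and the determinant
    -- gives the remaining entry.
    have : g = upperRightHom ((g 0 0 - 1) / g 1 0) * (swapGL F * upperRightHom (g 1 0) * swapGL F) *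
        upperRightHom ((g 1 1 - 1) / g 1 0) := by
      ext i j
      fin_cases i <;> fin_cases j <;>
        simp [swapGL, Matrix.mul_apply, Fin.sum_univ_two] <;> field_simp
      · ring
      · linear_combination -hg
      · ring
    rw [this]
    exact C.mul_mem (C.mul_mem (hu _) (hl _)) (hu _)
  by_cases hc : g 1 0 = 0
  · have ha : g 0 0 ≠ 0 := by
      rintro ha
      rw [Matrix.det_fin_two] at hg
      simp [ha, hc] at hg
    -- Adding the first row to the second makes the lower left entry equal to `g 0 0`, which is
    -- nonzero.
    refine (C.mul_mem_cancel_left (hl 1)).1 (main _ ?_ ?_)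
    · rw [Units.val_mul, Matrix.det_mul, hg]
      simp [swapGL, Matrix.det_fin_two]
    · simpa [swapGL, Matrix.mul_apply, Fin.sum_univ_two, hc] using ha
  · exact main g hg hc

end FieldGeneration

/-! ### Density of `Q` and `R` in the `p`-adic groups -/

section Density

open Filter Topology Matrix.GeneralLinearGroup

variable {p : ℕ} [hp : Fact p.Prime]

theorem Padic.exists_eq_inv_pow_mul_padicInt (x : ℚ_[p]) :
    ∃ (k : ℕ) (z : ℤ_[p]), x = (p : ℚ_[p])⁻¹ ^ k * z := by
  have hp0 : (p : ℚ_[p]) ≠ 0 := Nat.cast_ne_zero.2 hp.out.ne_zero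
  obtain ⟨k, hk⟩ := pow_unbounded_of_one_lt ‖x‖ (Nat.one_lt_cast.2 hp.out.one_lt : (1 : ℝ) < p)
  have hpk : (0 : ℝ) < (p : ℝ) ^ k := pow_pos (Nat.cast_pos.2 hp.out.pos) k
  refine ⟨k, ⟨(p : ℚ_[p]) ^ k * x, ?_⟩, ?_⟩
  · rw [norm_mul, norm_pow, Padic.norm_p, inv_pow, inv_mul_le_iff₀ hpk, mul_one]
    exact hk.le
  · rw [← mul_assoc, ← mul_pow, inv_mul_cancel₀ hp0, one_pow, one_mul]

theorem val_det_qToQp (q : GL (Fin 2) (ZInv p)) :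
    (qToQp p q : Matrix (Fin 2) (Fin 2) ℚ_[p]).det = ZInv.toPadic p (det q : (ZInv p)ˣ) :=
  ((ZInv.toPadic p).map_det _).symm

theorem qToQp_mem_detPM (q : GL (Fin 2) (ZInv p)) : qToQp p q ∈ detPM p := by
  obtain ⟨k, hk⟩ := ZInv.exists_zpow_of_unit (det q)
  refine ⟨k, ?_⟩
  rw [val_det_qToQp, ZInv.toPadic_apply]
  rcases hk with hk | hk
  · left; rw [hk]; push_cast; rfl
  · right; rw [hk]; push_cast; rfl

/-- Diagonal matrices with entries `± p ^ k` and 1 realize every allowed determinant, which reduces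
the density of `Q` to matrices of determinant 1. -/
theorem exists_det_qToQp_eq {g : GL (Fin 2) ℚ_[p]} (hg : g ∈ detPM p) :
    ∃ q : GL (Fin 2) (ZInv p), det (qToQp p q) = det g := by
  obtain ⟨k, hk⟩ := hg
  rcases hk with hk | hk
  · refine ⟨diagGL (ZInv.unitP p ^ k), Units.ext ?_⟩
    change Matrix.det _ = Matrix.det _
    rw [val_det_qToQp, hk, det_diagGL, ZInv.toPadic_apply, ZInv.coe_unitP_zpow]
    push_cast; rfl
  · refine ⟨diagGL (-ZInv.unitP p ^ k), Units.ext ?_⟩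
    change Matrix.det _ = Matrix.det _
    rw [val_det_qToQp, hk, det_diagGL, Units.val_neg, map_neg, ZInv.toPadic_apply,
      ZInv.coe_unitP_zpow]
    push_cast; rfl

theorem qToQp_upperRightHom (a : ZInv p) :
    qToQp p (upperRightHom a) = upperRightHom (ZInv.toPadic p a) := by
  ext i j
  rw [qToQp_apply]
  fin_cases i <;> fin_cases j <;> simp

/-- `GL(2, ℤ[1/p])` is dense in the group of `p`-adic matrices with determinant in `± p^ℤ`. -/
theorem detPM_le_topologicalClosure : detPM p ≤ (qToQp p).range.topologicalClosure := by
  have hle : (qToQp p).range ≤ (qToQp p).range.topologicalClosure :=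
    Subgroup.le_topologicalClosure _
  have hu : ∀ x : ℚ_[p], upperRightHom x ∈ (qToQp p).range.topologicalClosure := by
    intro x
    obtain ⟨k, z, rfl⟩ := Padic.exists_eq_inv_pow_mul_padicInt x
    -- With the power of `p⁻¹` fixed, density of `ℤ` in `ℤ_p` reduces to entries `p⁻ᵏ m` with `m` an
    -- integer, which lie in `ℤ[1/p]`.
    refine PadicInt.denseRange_intCast.induction_on (p := fun z : ℤ_[p] =>
      upperRightHom ((p : ℚ_[p])⁻¹ ^ k * z) ∈ (qToQp p).range.topologicalClosure) z ?_ fun m => ?_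
    · exact (Subgroup.isClosed_topologicalClosure _).preimage
        (continuous_upperRightHom.comp (by fun_prop))
    · refine hle ⟨upperRightHom (((ZInv.unitP p)⁻¹ : (ZInv p)ˣ) ^ k * m), ?_⟩
      rw [qToQp_upperRightHom, map_mul, map_pow, map_intCast]
      congr 3
      · exact Rat.cast_inv _ |>.trans (by simp)
  have hw : swapGL ℚ_[p] ∈ (qToQp p).range.topologicalClosure := by
    refine hle ⟨swapGL _, ?_⟩
    ext i j
    rw [qToQp_apply]
    fin_cases i <;> fin_cases j <;> simp [swapGL]
  intro g hg
  obtain ⟨q, hq⟩ := exists_det_qToQp_eq hg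
  refine (Subgroup.mul_mem_cancel_left _ (hle ⟨q⁻¹, rfl⟩)).1
    (mem_of_upperRightHom_mem_of_swapGL_mem hu hw ?_)
  change ((det (qToQp p q⁻¹ * g) : ℚ_[p]ˣ) : ℚ_[p]) = 1
  rw [map_mul, map_inv, map_inv, hq, inv_mul_cancel, Units.val_one]

/-- The determinant of a matrix in `GL(2, ℤ_p)` has norm 1, so if it is `± p ^ k` then `k = 0`. -/
theorem map_SLpm_eq : (SLpm ℤ_[p]).map (zpToQp p) = detPM p ⊓ (zpToQp p).range := by
  have hdet : ∀ g : GL (Fin 2) ℤ_[p], (zpToQp p g : Matrix (Fin 2) (Fin 2) ℚ_[p]).det =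
      ((det g : ℤ_[p]ˣ) : ℤ_[p]) := fun g => (PadicInt.Coe.ringHom.map_det _).symm
  ext x
  constructor
  · rintro ⟨g, hg, rfl⟩
    refine ⟨⟨0, ?_⟩, g, rfl⟩
    rw [hdet]
    rcases hg with hg | hg
    · left; simp [hg]
    · right; simp [hg]
  · rintro ⟨⟨k, hk⟩, g, rfl⟩
    refine ⟨g, ?_, rfl⟩
    have hp1 : (1 : ℝ) < p := Nat.one_lt_cast.2 hp.out.one_lt
    have hn := PadicInt.norm_units (det g)
    rw [PadicInt.norm_def, ← hdet] at hn
    have hk0 : k = 0 := by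
      have : (p : ℝ) ^ (-k) = 1 := by
        rcases hk with hk | hk <;> rw [hk] at hn <;> simpa using hn
      have := (zpow_eq_one_iff_right₀ (by positivity) hp1.ne').1 this
      omega
    subst hk0
    rw [hdet] at hk
    refine hk.imp (fun h => ?_) fun h => ?_
    · exact Units.ext (Subtype.ext (by rw [h, zpow_zero]; rfl))
    · exact Units.ext (Subtype.ext (by rw [h, zpow_zero]; rfl))

theorem isClosed_SLpm : IsClosed (SLpm ℤ_[p] : Set (GL (Fin 2) ℤ_[p])) := by
  have : (SLpm ℤ_[p] : Set (GL (Fin 2) ℤ_[p])) = det ⁻¹' {1, -1} := rfl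
  rw [this]
  exact (Set.toFinite {1, -1}).isClosed.preimage Matrix.GeneralLinearGroup.continuous_det

instance : CompactSpace (SLpm ℤ_[p]) := isCompact_iff_compactSpace.1 isClosed_SLpm.isCompact

theorem isOpen_range_zpToQp : IsOpen ((zpToQp p).range : Set (GL (Fin 2) ℚ_[p])) :=
  (isOpenEmbedding_map_padicInt (p := p) (n := Fin 2)).isOpen_range

theorem isOpenEmbedding_zpToQp : IsOpenEmbedding (zpToQp p) :=
  isOpenEmbedding_map_padicInt

/-- `SL_±(2, ℤ_p)` is a compact neighbourhood of 1: it is the trace of the open subgroup `GL(2,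
ℤ_p)`. -/
instance : LocallyCompactSpace (detPM p) := by
  have hc : IsCompact (((SLpm ℤ_[p]).map (zpToQp p) : Subgroup (GL (Fin 2) ℚ_[p])) :
      Set (GL (Fin 2) ℚ_[p])) :=
    isClosed_SLpm.isCompact.image isOpenEmbedding_zpToQp.continuous
  have hc' : IsCompact ((↑) ⁻¹' ((zpToQp p).range : Set (GL (Fin 2) ℚ_[p])) : Set (detPM p)) := by
    rw [map_SLpm_eq] at hc
    rw [Subtype.isCompact_iff]
    convert hc
    exact Subtype.image_preimage_coe _ _
  refine hc'.locallyCompactSpace_of_mem_nhds_of_group (x := 1) ?_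
  exact (isOpen_range_zpToQp.preimage continuous_subtype_val).mem_nhds (one_mem (zpToQp p).range)

/-- The inclusion of `GL(2, ℤ[1/p])` into the group of `p`-adic matrices with determinant in
`± p^ℤ`. -/
noncomputable def qToDetPM (p : ℕ) [Fact p.Prime] : GL (Fin 2) (ZInv p) →* detPM p :=
  (qToQp p).codRestrict _ qToQp_mem_detPM

theorem denseRange_qToDetPM : DenseRange (qToDetPM p) :=
  denseRange_codRestrict_of_closure _ fun _ hx => detPM_le_topologicalClosure hx

theorem intToZp_mem_SLpm (r : GL (Fin 2) ℤ) : intToZp p r ∈ SLpm ℤ_[p] := by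
  have h : det (intToZp p r) = Units.map (Int.castRingHom ℤ_[p]).toMonoidHom (det r) :=
    Units.ext ((Int.castRingHom ℤ_[p]).map_det _).symm
  rcases Int.units_eq_one_or (det r) with hr | hr
  · left; rw [h, hr, map_one]
  · right; rw [h, hr]; ext; simp

/-- The inclusion of `GL(2, ℤ)` into `SL_±(2, ℤ_p)`. -/
noncomputable def intToSLpm (p : ℕ) [Fact p.Prime] : GL (Fin 2) ℤ →* SLpm ℤ_[p] :=
  (intToZp p).codRestrict _ intToZp_mem_SLpm

/-- An open subset of `GL(2, ℤ_p)` is open in `GL(2, ℚ_p)`, so if it meets `SL_±(2, ℤ_p)` it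
contains a point of the dense group `Q`; being integral at `p`, that point lies in `R`. -/
theorem denseRange_intToSLpm : DenseRange (intToSLpm p) := by
  refine denseRange_codRestrict_of_closure _ fun s hs => mem_closure_iff.2 fun V hV hsV => ?_
  have h1 : zpToQp p s ∈ detPM p ⊓ (zpToQp p).range := by
    rw [← map_SLpm_eq]; exact ⟨s, hs, rfl⟩
  obtain ⟨_, ⟨v, hv, hvq⟩, q, rfl⟩ := mem_closure_iff.1 (detPM_le_topologicalClosure h1.1) _
    (isOpenEmbedding_zpToQp.isOpenMap _ hV) ⟨s, hsV, rfl⟩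
  obtain ⟨r, -, rfl⟩ := mem_subR_of_qToQp_eq hvq.symm
  exact ⟨_, hv, r, rfl⟩

theorem comap_nhds_one_intToSLpm :
    comap (intToSLpm p) (𝓝 1) = comap (intToQ p) (comap (qToDetPM p) (𝓝 1)) := by
  rw [comap_nhds_one_codRestrict, comap_nhds_one_codRestrict, comap_comap]
  have h : ((fun q => (qToDetPM p q : GL (Fin 2) ℚ_[p])) ∘ intToQ p) =
      zpToQp p ∘ intToZp p := funext fun r => (zpToQp_intToZp r).symm
  rw [h, ← comap_comap, ← map_one (zpToQp p), ← isOpenEmbedding_zpToQp.isInducing.nhds_eq_comap]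
  rfl

/-- The group of `p`-adic matrices with determinant in `± p^ℤ` is the union of the cosets
`q SL_±(2, ℤ_p)` with `q` in `GL(2, ℤ[1/p])`. -/
theorem iUnion_smul_SLpm_eq (s : GL (Fin 2) (ZInv p) ⧸ subR p → GL (Fin 2) (ZInv p))
    (hs : ∀ c, (QuotientGroup.mk (s c) : GL (Fin 2) (ZInv p) ⧸ subR p) = c) :
    ⋃ c, qToQp p (s c) • (((SLpm ℤ_[p]).map (zpToQp p) : Subgroup (GL (Fin 2) ℚ_[p])) :
      Set (GL (Fin 2) ℚ_[p])) = (detPM p : Set (GL (Fin 2) ℚ_[p])) := by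
  apply Set.Subset.antisymm
  · refine Set.iUnion_subset fun c => ?_
    rintro _ ⟨x, hx, rfl⟩
    rw [map_SLpm_eq] at hx
    exact (detPM p).mul_mem (qToQp_mem_detPM _) hx.1
  · intro g hg
    -- The open coset `g GL(2, ℤ_p)` meets the dense group `Q`, giving `g k = q`.
    obtain ⟨_, ⟨k, hk, hkq⟩, q, rfl⟩ := mem_closure_iff.1 (detPM_le_topologicalClosure hg) _
      (isOpen_range_zpToQp.leftCoset g) ⟨1, one_mem _, by simp⟩
    refine Set.mem_iUnion.2 ⟨QuotientGroup.mk q, Set.mem_smul_set_iff_inv_smul_mem.2 ?_⟩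
    have h := QuotientGroup.eq.1 (hs (QuotientGroup.mk q))
    obtain ⟨r, hr⟩ := h
    rw [SetLike.mem_coe, map_SLpm_eq, smul_eq_mul]
    refine ⟨(detPM p).mul_mem ((detPM p).inv_mem (qToQp_mem_detPM _)) hg, ?_⟩
    have h1 : g = qToQp p q * k⁻¹ := by simp only [smul_eq_mul] at hkq; rw [← hkq]; simp
    rw [h1, ← mul_assoc, ← map_inv, ← map_mul, ← hr, ← zpToQp_intToZp]
    exact (zpToQp p).range.mul_mem ⟨_, rfl⟩ ((zpToQp p).range.inv_mem hk)

end Density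

/-! ### The affine model in `GL(3, ℚ_p)` and the topology induced on `Q` -/

section AffineMatrices

open Filter Topology

/-- The affine group as a group of block matrices. -/
def affToMatrix (J : Type*) [CommRing J] :
    Multiplicative (Fin 2 → J) ⋊[glAction J] GL (Fin 2) J →* Matrix (Fin 2 ⊕ Unit) (Fin 2 ⊕ Unit) J where
  toFun g := Matrix.fromBlocks (g.right : Matrix (Fin 2) (Fin 2) J)
    (Matrix.replicateCol Unit g.left.toAdd) 0 1
  map_one' := by
    simp [← Matrix.fromBlocks_one]
  map_mul' g h := by
    rw [Matrix.fromBlocks_multiply]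
    congr 1
    · simp
    · rw [← Matrix.replicateCol_mulVec, Matrix.mul_one, SemidirectProduct.mul_left, toAdd_mul,
        Matrix.replicateCol_add, add_comm]
      rfl
    · simp
    · simp

/-- For `v = p⁻ⁿ eⱼ`, integrality of this translation part says that column `j` of `q - 1` is
divisible by `pⁿ`. -/
theorem conj_inr_left_apply {J : Type*} [CommRing J] (v : Multiplicative (Fin 2 → J))
    (q : GL (Fin 2) J) :
    ((SemidirectProduct.inl v)⁻¹ * SemidirectProduct.inr q * SemidirectProduct.inl v :
      Multiplicative (Fin 2 → J) ⋊[glAction J] GL (Fin 2) J).left.toAdd =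
      (q : Matrix (Fin 2) (Fin 2) J).mulVec v.toAdd - v.toAdd := by
  rw [← map_inv, ← neg_add_eq_sub, SemidirectProduct.mul_left, SemidirectProduct.mul_left,
    SemidirectProduct.mul_right, SemidirectProduct.left_inl, SemidirectProduct.left_inl,
    SemidirectProduct.right_inl, SemidirectProduct.left_inr, SemidirectProduct.right_inr, map_one,
    one_mul, mul_one]
  rfl

/-- The inclusion of block-diagonal matrices `A ⊕ 1`. -/
def blockOne (J : Type*) [CommRing J] :
    Matrix (Fin 2) (Fin 2) J →* Matrix (Fin 2 ⊕ Unit) (Fin 2 ⊕ Unit) J where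
  toFun A := Matrix.fromBlocks A 0 0 1
  map_one' := Matrix.fromBlocks_one
  map_mul' A B := by simp [Matrix.fromBlocks_multiply]

variable {p : ℕ} [hp : Fact p.Prime]

theorem ZInv.toPadic_unitP_zpow_neg (k : ℕ) :
    ZInv.toPadic p ((ZInv.unitP p ^ (-k : ℤ) : (ZInv p)ˣ) : ZInv p) = ((p : ℚ_[p]) ^ k)⁻¹ := by
  rw [ZInv.toPadic_apply, ZInv.coe_unitP_zpow, zpow_neg, zpow_natCast]
  push_cast
  rfl

theorem coe_qToQp_scalar (u : (ZInv p)ˣ) :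
    (qToQp p (Matrix.GeneralLinearGroup.scalar (Fin 2) u) : Matrix (Fin 2) (Fin 2) ℚ_[p]) =
      Matrix.scalar (Fin 2) (ZInv.toPadic p u) := by
  ext i j
  change ZInv.toPadic p (Matrix.scalar (Fin 2) (u : ZInv p) i j) = _
  by_cases hij : i = j <;> simp [Matrix.scalar_apply, hij]

theorem Padic.eq_zero_of_forall_norm_le {x : ℚ_[p]}
    (h : ∀ k : ℕ, ‖((p : ℚ_[p]) ^ k)⁻¹ * x‖ ≤ 1) : x = 0 := by
  by_contra hx
  have hx' : 0 < ‖x‖ := norm_pos_iff.2 hx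
  obtain ⟨k, hk⟩ := pow_unbounded_of_one_lt ‖x‖⁻¹ (Nat.one_lt_cast.2 hp.out.one_lt : (1 : ℝ) < p)
  have := h k
  rw [norm_mul, norm_inv, norm_pow, Padic.norm_p, inv_pow, inv_inv] at this
  rw [inv_lt_iff_one_lt_mul₀ hx'] at hk
  linarith

/-- The embedding of `N ⋊ Q` into `GL(3, ℚ_p)`. -/
noncomputable def affToPadic (p : ℕ) [Fact p.Prime] : AffG p →* GL (Fin 2 ⊕ Unit) ℚ_[p] :=
  (Matrix.GeneralLinearGroup.map (ZInv.toPadic p)).comp (affToMatrix (ZInv p)).toHomUnits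

theorem coe_affToPadic (g : AffG p) :
    (affToPadic p g : Matrix (Fin 2 ⊕ Unit) (Fin 2 ⊕ Unit) ℚ_[p]) =
      Matrix.fromBlocks (qToQp p g.right : Matrix (Fin 2) (Fin 2) ℚ_[p])
        (Matrix.replicateCol Unit fun i => ZInv.toPadic p (g.left.toAdd i)) 0 1 := by
  ext i j
  change ZInv.toPadic p (Matrix.fromBlocks (g.right : Matrix (Fin 2) (Fin 2) (ZInv p))
    (Matrix.replicateCol Unit g.left.toAdd) 0 1 i j) = _
  rcases i with i | i <;> rcases j with j | j <;> simp [qToQp_apply]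

theorem affToPadic_injective : Function.Injective (affToPadic p) := by
  refine (injective_iff_map_eq_one _).2 fun g hg => ?_
  have h := congrArg Units.val hg
  rw [coe_affToPadic, Units.val_one, ← Matrix.fromBlocks_one, Matrix.fromBlocks_inj] at h
  refine SemidirectProduct.ext ?_ (qToQp_injective ((Units.ext h.1).trans (map_one _).symm))
  refine Multiplicative.toAdd.injective (funext fun i => ZInv.toPadic_injective ?_)
  exact (congrFun (congrFun h.2.1 i) ()).trans (map_zero _).symm

/-- The compact open subgroup `GL(3, ℤ_p)` of `GL(3, ℚ_p)`. -/
noncomputable def integralSubgroup (p : ℕ) [Fact p.Prime] : Subgroup (GL (Fin 2 ⊕ Unit) ℚ_[p]) :=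
  (Matrix.GeneralLinearGroup.map (PadicInt.Coe.ringHom (p := p))).range

theorem isOpen_integralSubgroup : IsOpen (integralSubgroup p : Set (GL (Fin 2 ⊕ Unit) ℚ_[p])) :=
  (isOpenEmbedding_map_padicInt (p := p) (n := Fin 2 ⊕ Unit)).isOpen_range

theorem isCompact_integralSubgroup :
    IsCompact (integralSubgroup p : Set (GL (Fin 2 ⊕ Unit) ℚ_[p])) :=
  isCompact_range (isOpenEmbedding_map_padicInt (p := p) (n := Fin 2 ⊕ Unit)).continuous

theorem norm_apply_le_one_of_mem_integralSubgroup {g : GL (Fin 2 ⊕ Unit) ℚ_[p]}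
    (hg : g ∈ integralSubgroup p) (i j : Fin 2 ⊕ Unit) : ‖g i j‖ ≤ 1 := by
  obtain ⟨k, rfl⟩ := hg
  exact (k i j).2

/-- Entries in `ℤ[1/p]` that are integral at `p` are integers. Applying this also to the inverse
puts the linear part in `GL(2, ℤ)`. Thus `H` is the preimage of a compact open subgroup. -/
theorem comap_integralSubgroup : (integralSubgroup p).comap (affToPadic p) = subH p := by
  apply le_antisymm
  · intro g hg
    have hR : ∀ g : AffG p, g ∈ (integralSubgroup p).comap (affToPadic p) →
        ∀ i j, ‖qToQp p g.right i j‖ ≤ 1 := by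
      intro g hg i j
      simpa [coe_affToPadic] using norm_apply_le_one_of_mem_integralSubgroup hg (.inl i) (.inl j)
    refine ⟨?_, ?_⟩
    · have : ∀ i, ∃ m : ℤ, g.left.toAdd i = m := fun i =>
        ZInv.exists_intCast_of_norm_le_one _ (by
          simpa [coe_affToPadic] using
            norm_apply_le_one_of_mem_integralSubgroup hg (.inl i) (.inr ()))
      choose m hm using this
      exact ⟨m, hm⟩
    · obtain ⟨k, hk⟩ := exists_map_padicInt_eq (qToQp p g.right) (hR g hg) (by
        simpa using hR g⁻¹ (inv_mem hg))
      obtain ⟨r, hr, -⟩ := mem_subR_of_qToQp_eq hk.symm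
      exact ⟨r, hr⟩
  · have key : ∀ g ∈ subH p, ∀ i j, ‖affToPadic p g i j‖ ≤ 1 := by
      rintro g ⟨⟨m, hm⟩, r, hr⟩ i j
      rw [coe_affToPadic, ← hr, ← zpToQp_intToZp]
      rcases i with i | i <;> rcases j with j | j
      · exact (intToZp p r i j).2
      · simpa [hm] using Padic.norm_int_le_one (p := p) (m i)
      · simp
      · simp
    intro g hg
    exact exists_map_padicInt_eq _ (key g hg) (by simpa using key g⁻¹ (inv_mem hg))

/-- The last column of a conjugate of an affine matrix. -/
theorem conj_affToPadic_apply (g : AffG p) (l : GL (Fin 2 ⊕ Unit) ℚ_[p])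
    (A : Matrix (Fin 2) (Fin 2) ℚ_[p]) (b : Fin 2 → ℚ_[p])
    (hl : (l : Matrix (Fin 2 ⊕ Unit) (Fin 2 ⊕ Unit) ℚ_[p]) =
      Matrix.fromBlocks A (Matrix.replicateCol Unit b) 0 1) (i : Fin 2) :
    ((affToPadic p g)⁻¹ * l * affToPadic p g) (.inl i) (.inr ()) =
      ((qToQp p g.right⁻¹ : Matrix (Fin 2) (Fin 2) ℚ_[p]).mulVec
        (A.mulVec (fun i => ZInv.toPadic p (g.left.toAdd i)) + b -
          fun i => ZInv.toPadic p (g.left.toAdd i))) i := by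
  have hinv : (fun i => ZInv.toPadic p (g⁻¹.left.toAdd i)) =
      -(qToQp p g.right⁻¹ : Matrix (Fin 2) (Fin 2) ℚ_[p]).mulVec
        (fun i => ZInv.toPadic p (g.left.toAdd i)) := by
    have hneg : ZInv.toPadic p ∘ (-g.left.toAdd) = -fun i => ZInv.toPadic p (g.left.toAdd i) :=
      funext fun j => map_neg (ZInv.toPadic p) _
    rw [← Matrix.mulVec_neg, ← hneg]
    exact funext fun i => (ZInv.toPadic p).map_mulVec _ _ i
  rw [← map_inv, Units.val_mul, Units.val_mul, coe_affToPadic, coe_affToPadic, hl,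
    Matrix.fromBlocks_multiply, Matrix.fromBlocks_multiply, Matrix.fromBlocks_apply₁₂, hinv,
    SemidirectProduct.inv_right, Matrix.mul_zero, add_zero, Matrix.mul_one, Matrix.mul_one,
    ← Matrix.replicateCol_mulVec, ← Matrix.replicateCol_mulVec, Matrix.add_apply, Matrix.add_apply,
    Matrix.mulVec_sub, Matrix.mulVec_add, Matrix.mulVec_mulVec]
  simp only [Matrix.replicateCol_apply, Pi.sub_apply, Pi.add_apply, Pi.neg_apply]
  ring

/-- The affine block shape is a closed condition, so `l` has a linear part `A` and a translation
part `b`. Conjugating by scalars and by translations with arbitrarily large denominators makes `b`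
and `A - 1` divisible by every power of `p`. -/
theorem eq_one_of_forall_conj_mem_integralSubgroup {l : GL (Fin 2 ⊕ Unit) ℚ_[p]}
    (hl : l ∈ (affToPadic p).range.topologicalClosure)
    (h : ∀ g, (affToPadic p g)⁻¹ * l * affToPadic p g ∈ integralSubgroup p) : l = 1 := by
  have hcl : ∀ (i j : Fin 2 ⊕ Unit) (c : ℚ_[p]), (∀ g, affToPadic p g i j = c) → l i j = c := by
    intro i j c hc
    refine closure_minimal (s := Set.range (affToPadic p)) (t := {l | l i j = c}) ?_ ?_ hl
    · rintro _ ⟨g, rfl⟩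
      exact hc g
    · exact isClosed_eq (Units.continuous_val.matrix_elem _ _) continuous_const
  obtain ⟨A, b, hA⟩ : ∃ A b, (l : Matrix (Fin 2 ⊕ Unit) (Fin 2 ⊕ Unit) ℚ_[p]) =
      Matrix.fromBlocks A (Matrix.replicateCol Unit b) 0 1 := by
    refine ⟨.of fun i j => l (.inl i) (.inl j), fun i => l (.inl i) (.inr ()), ?_⟩
    ext i j
    rcases i with i | i <;> rcases j with j | j
    · rfl
    · rfl
    · exact hcl _ _ _ fun g => by simp [coe_affToPadic]
    · exact hcl _ _ _ fun g => by simp [coe_affToPadic]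
  have key : ∀ (g : AffG p) (i : Fin 2), ‖((qToQp p g.right⁻¹ : Matrix (Fin 2) (Fin 2) ℚ_[p]).mulVec
        (A.mulVec (fun i => ZInv.toPadic p (g.left.toAdd i)) + b -
          fun i => ZInv.toPadic p (g.left.toAdd i))) i‖ ≤ 1 := by
    intro g i
    rw [← conj_affToPadic_apply g l A b hA]
    exact norm_apply_le_one_of_mem_integralSubgroup (h g) _ _
  have hb : b = 0 := by
    ext i
    refine Padic.eq_zero_of_forall_norm_le fun k => ?_
    -- Conjugation by the scalar `p ^ k` multiplies `b` by `p⁻ᵏ`.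
    have := key (SemidirectProduct.inr
      (Matrix.GeneralLinearGroup.scalar (Fin 2) (ZInv.unitP p ^ (-k : ℤ))⁻¹)) i
    have hz : (fun i => ZInv.toPadic p ((SemidirectProduct.inr
        (Matrix.GeneralLinearGroup.scalar (Fin 2) (ZInv.unitP p ^ (-k : ℤ))⁻¹) :
          AffG p).left.toAdd i)) = 0 := funext fun i => map_zero (ZInv.toPadic p)
    rw [hz, SemidirectProduct.right_inr, ← map_inv (Matrix.GeneralLinearGroup.scalar (Fin 2)),
      inv_inv, coe_qToQp_scalar, ZInv.toPadic_unitP_zpow_neg, Matrix.mulVec_zero, zero_add,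
      sub_zero, Matrix.scalar_apply, Matrix.mulVec_diagonal] at this
    exact this
  have hA1 : A = 1 := by
    ext i j
    rw [← sub_eq_zero]
    refine Padic.eq_zero_of_forall_norm_le fun k => ?_
    -- As `b = 0`, conjugation by the translation `p⁻ᵏ eⱼ` produces `p⁻ᵏ` times column `j` of `A -
    -- 1`.
    have := key (SemidirectProduct.inl (Multiplicative.ofAdd
      (Pi.single j (((ZInv.unitP p ^ (-k : ℤ) : (ZInv p)ˣ) : ZInv p))))) i
    have hs : (fun i => ZInv.toPadic p ((Pi.single j
        ((ZInv.unitP p ^ (-k : ℤ) : (ZInv p)ˣ) : ZInv p) : Fin 2 → ZInv p) i)) =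
        Pi.single j ((p : ℚ_[p]) ^ k)⁻¹ := by
      rw [← ZInv.toPadic_unitP_zpow_neg]
      ext i
      by_cases hij : i = j
      · subst hij; simp
      · simp [hij]
    rw [SemidirectProduct.left_inl, SemidirectProduct.right_inl, toAdd_ofAdd, hs, hb] at this
    by_cases hij : i = j
    · subst hij
      simpa [mul_sub, mul_comm] using this
    · simpa [hij, Matrix.one_apply, mul_comm] using this
  refine Units.ext ?_
  rw [hA, hb, hA1, Matrix.replicateCol_zero, Matrix.fromBlocks_one, Units.val_one]

/-- The closure of `N ⋊ Q` in `GL(3, ℚ_p)` is a Schlichting completion. -/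
theorem isSchlichtingCompletion_toClosureRange :
    IsSchlichtingCompletion (subH p) (toClosureRange (affToPadic p))
      ((integralSubgroup p).subgroupOf (affToPadic p).range.topologicalClosure) := by
  have hcl : IsClosedEmbedding
      ((↑) : (affToPadic p).range.topologicalClosure → GL (Fin 2 ⊕ Unit) ℚ_[p]) :=
    (Subgroup.isClosed_topologicalClosure _).isClosedEmbedding_subtypeVal
  have ho : IsOpen ((integralSubgroup p).subgroupOf (affToPadic p).range.topologicalClosure :
      Set (affToPadic p).range.topologicalClosure) :=
    isOpen_integralSubgroup.preimage continuous_subtype_val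
  have hc : IsCompact ((integralSubgroup p).subgroupOf (affToPadic p).range.topologicalClosure :
      Set (affToPadic p).range.topologicalClosure) :=
    hcl.isCompact_preimage isCompact_integralSubgroup
  refine ⟨⟨isHeckePair_of_isCompact_isOpen hc ho, ?_, hcl.locallyCompactSpace, inferInstance, hc, ho⟩,
    denseRange_toClosureRange _, comap_integralSubgroup.symm⟩
  exact isReducedPair_iff.2 fun l hl => Subtype.ext <|
    eq_one_of_forall_conj_mem_integralSubgroup l.2 fun g => hl (toClosureRange (affToPadic p) g)

variable {L : Type*} [Group L] [TopologicalSpace L] [IsTopologicalGroup L]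
  {σ : AffG p →* L} {K : Subgroup L}

omit hp in
theorem inQ_mem_subH_iff (q : GL (Fin 2) (ZInv p)) : inQ p q ∈ subH p ↔ q ∈ subR p :=
  ⟨fun h => h.2, fun h => ⟨one_mem _, h⟩⟩

/-- `GL(2, ℚ_p)` as a group of block-diagonal matrices. -/
noncomputable def blockOneGL (p : ℕ) [Fact p.Prime] :
    GL (Fin 2) ℚ_[p] →* GL (Fin 2 ⊕ Unit) ℚ_[p] :=
  Units.map (blockOne ℚ_[p])

theorem blockOneGL_qToQp (q : GL (Fin 2) (ZInv p)) :
    blockOneGL p (qToQp p q) = affToPadic p (inQ p q) := by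
  refine Units.ext ?_
  rw [coe_affToPadic]
  change Matrix.fromBlocks _ _ _ _ = _
  congr 1

theorem continuous_blockOneGL : Continuous (blockOneGL p) :=
  Units.continuous_map (Continuous.matrix_fromBlocks continuous_id continuous_const
    continuous_const continuous_const)

/-- Every Schlichting completion of `(N ⋊ Q, M ⋊ R)` induces the `p`-adic topology on `Q`. -/
theorem IsSchlichtingCompletion.comap_nhds_one_inQ
    (hK : IsSchlichtingCompletion (subH p) σ K) :
    comap (σ.comp (inQ p)) (𝓝 1) = comap (qToQp p) (𝓝 1) := by
  have conj_mem : ∀ g : AffG p, {l : L | (σ g)⁻¹ * l * σ g ∈ K} ∈ 𝓝 (1 : L) := fun g =>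
    (hK.pair.isOpen.preimage (by fun_prop : Continuous fun l : L => (σ g)⁻¹ * l * σ g)).mem_nhds
      (by simp)
  apply le_antisymm
  · intro S hS
    obtain ⟨V, hV, hVS⟩ := hS
    have hV' : zpToQp p ⁻¹' V ∈ 𝓝 1 :=
      isOpenEmbedding_zpToQp.continuous.continuousAt.preimage_mem_nhds (by rwa [map_one])
    obtain ⟨n, -, hn⟩ := hasBasis_comap_intToZp.mem_iff.1 (preimage_mem_comap (m := intToZp p) hV')
    let t : Fin 2 → AffG p := fun j => SemidirectProduct.inl (Multiplicative.ofAdd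
      (Pi.single j ((ZInv.unitP p ^ (-n : ℤ) : (ZInv p)ˣ) : ZInv p)))
    -- Membership in `K` forces `q` into `R`; the two conjugates by `p⁻ⁿ eⱼ` then force it into
    -- `R(pⁿ)`, one column each.
    refine ⟨K ∩ ⋂ j, {l : L | (σ (t j))⁻¹ * l * σ (t j) ∈ K},
      inter_mem (hK.pair.isOpen.mem_nhds K.one_mem) (iInter_mem.2 fun j => conj_mem _), ?_⟩
    rintro q ⟨hqK, hqt⟩
    obtain ⟨r, rfl⟩ := (inQ_mem_subH_iff q).1 ((hK.mem_iff _).1 hqK)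
    refine hVS ?_
    rw [Set.mem_preimage, ← zpToQp_intToZp]
    refine hn ((mem_congR p n r).2 fun i j => ?_)
    have hj := Set.mem_iInter.1 hqt j
    rw [Set.mem_ofPred_eq, MonoidHom.comp_apply, ← map_inv, ← map_mul, ← map_mul, hK.mem_iff] at hj
    obtain ⟨m, hm⟩ := hj.1
    have hm := hm i
    rw [conj_inr_left_apply, toAdd_ofAdd, Matrix.mulVec_single, Pi.sub_apply, Pi.smul_apply,
      Matrix.col_apply, op_smul_eq_mul] at hm
    have hm' : ((r : Matrix (Fin 2) (Fin 2) ℤ) i j : ZInv p) *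
        ((ZInv.unitP p ^ (-n : ℤ) : (ZInv p)ˣ) : ZInv p) - (1 : Matrix (Fin 2) (Fin 2) (ZInv p)) i j *
        ((ZInv.unitP p ^ (-n : ℤ) : (ZInv p)ˣ) : ZInv p) = m i := by
      rw [← hm, Matrix.one_apply, Pi.single_apply, ite_mul, one_mul, zero_mul]
      rfl
    have hpn : ((ZInv.unitP p ^ (n : ℤ) : (ZInv p)ˣ) : ZInv p) = ((p ^ n : ℤ) : ZInv p) := by
      rw [zpow_natCast, Units.val_pow_eq_pow_val]
      push_cast
      rfl
    rw [← sub_mul, zpow_neg, Units.mul_inv_eq_iff_eq_mul, hpn] at hm'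
    refine ⟨m i, Int.cast_injective (α := ZInv p) ?_⟩
    rw [mul_comm, Int.cast_mul, ← hm']
    rw [Matrix.sub_apply, Matrix.one_apply, Matrix.one_apply]
    split_ifs <;> simp
  · intro S hS
    obtain ⟨V, hV, hVS⟩ := hS
    -- Each of these finitely many conditions on `q` is membership in a conjugate of `H`, which
    -- holds as soon as a conjugate of the block matrix of `q` lies in the open group `GL(3, ℤ_p)`.
    -- The trivial conjugate `key 1` accounts for `K` itself.
    obtain ⟨F, hF⟩ := hK.exists_finset_of_mem_nhds_one hV
    have key : ∀ g : AffG p, {x : GL (Fin 2) ℚ_[p] |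
        (affToPadic p g)⁻¹ * blockOneGL p x * affToPadic p g ∈ integralSubgroup p} ∈ 𝓝 1 := by
      intro g
      have hc : Continuous fun x : GL (Fin 2) ℚ_[p] =>
          (affToPadic p g)⁻¹ * blockOneGL p x * affToPadic p g :=
        (continuous_const.mul continuous_blockOneGL).mul continuous_const
      exact (isOpen_integralSubgroup.preimage hc).mem_nhds (by simp [one_mem])
    have key' : ∀ (g : AffG p) (q : GL (Fin 2) (ZInv p)),
        (affToPadic p g)⁻¹ * blockOneGL p (qToQp p q) * affToPadic p g ∈ integralSubgroup p →
        (σ g)⁻¹ * σ (inQ p q) * σ g ∈ K := by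
      intro g q h
      rw [blockOneGL_qToQp, ← map_inv, ← map_mul, ← map_mul, ← Subgroup.mem_comap,
        comap_integralSubgroup] at h
      rwa [← map_inv, ← map_mul, ← map_mul, hK.mem_iff]
    refine ⟨_, inter_mem (key 1) ((biInter_finset_mem F).2 fun g _ => key g), fun q hq => hVS ?_⟩
    refine hF _ (by simpa using key' 1 q hq.1) fun g hg => ?_
    exact key' g q (Set.mem_iInter₂.1 hq.2 g hg)

end AffineMatrices

/-! ### The inverse limit of the `R / R(pⁿ)` -/

section InverseLimit

open Filter Topology

variable {p : ℕ}

theorem finite_quotR [hp : Fact p.Prime] (n : ℕ) : Finite (QuotR p n) := by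
  have : NeZero (p ^ n) := ⟨pow_ne_zero n hp.out.ne_zero⟩
  have : Finite (GL (Fin 2) (ZMod (p ^ n))) := inferInstance
  exact Finite.of_injective _ (QuotientGroup.kerLift_injective
    (Matrix.GeneralLinearGroup.map (n := Fin 2) (Int.castRingHom (ZMod (p ^ n)))))

theorem isClosed_invLimR : IsClosed (invLimR p : Set (∀ n : ℕ, QuotR p n)) := by
  have : (invLimR p : Set (∀ n : ℕ, QuotR p n)) =
      ⋂ (m : ℕ) (k : ℕ) (h : m ≤ k),
      {x | transR p h (x k) = x m} := by
    ext x
    simp only [Set.mem_iInter]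
    rfl
  rw [this]
  exact isClosed_iInter fun m => isClosed_iInter fun n => isClosed_iInter fun h =>
    isClosed_eq (continuous_of_discreteTopology.comp (continuous_apply n)) (continuous_apply m)

instance [Fact p.Prime] : CompactSpace (invLimR p) := by
  have (n : ℕ) : Finite (QuotR p n) := finite_quotR _
  exact isCompact_iff_compactSpace.1 isClosed_invLimR.isCompact

/-- The diagonal homomorphism from `R` to the inverse limit of the `R / R(pⁿ)`. -/
def intToInvLim (p : ℕ) : GL (Fin 2) ℤ →* invLimR p where
  toFun r := ⟨fun n => QuotientGroup.mk r, fun _ _ _ => rfl⟩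
  map_one' := rfl
  map_mul' _ _ := rfl

theorem intToInvLim_apply (r : GL (Fin 2) ℤ) (n : ℕ) :
    (intToInvLim p r).1 n = QuotientGroup.mk r := rfl

/-- The sets of coherent families with a prescribed value at one level form a neighbourhood base. -/
theorem hasBasis_nhds_invLimR (x : invLimR p) :
    (𝓝 x).HasBasis (fun _ : ℕ => True) fun n => {y | y.1 n = x.1 n} := by
  refine ⟨fun S => ⟨fun hS => ?_, ?_⟩⟩
  · obtain ⟨U, hU, hUS⟩ := mem_nhds_subtype _ _ _ |>.1 hS
    rw [nhds_pi, Filter.mem_pi'] at hU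
    obtain ⟨I, t, ht, htU⟩ := hU
    refine ⟨I.sup id, trivial, fun y hy => hUS (htU fun i hi => ?_)⟩
    have hi' : i ≤ I.sup id := Finset.le_sup (f := id) hi
    have : y.1 i = x.1 i := by
      rw [← y.2 i _ hi', ← x.2 i _ hi']
      exact congrArg _ hy
    rw [this]
    exact mem_of_mem_nhds (ht i)
  · rintro ⟨n, -, hn⟩
    refine mem_of_superset ?_ hn
    have hc : Continuous fun y : invLimR p => y.1 n := (continuous_apply n).comp continuous_subtype_val
    exact ((isOpen_discrete {x.1 n}).preimage hc).mem_nhds rfl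

theorem exists_intToInvLim_eq (x : invLimR p) (n : ℕ) : ∃ r, (intToInvLim p r).1 n = x.1 n :=
  QuotientGroup.mk_surjective (x.1 n)

theorem denseRange_intToInvLim : DenseRange (intToInvLim p) := by
  intro x
  refine (mem_closure_iff_nhds_basis (hasBasis_nhds_invLimR x)).2 fun n _ => ?_
  obtain ⟨r, hr⟩ := exists_intToInvLim_eq x n
  exact ⟨_, ⟨r, rfl⟩, hr⟩

theorem comap_nhds_one_intToInvLim :
    (comap (intToInvLim p) (𝓝 1)).HasBasis (fun _ : ℕ => True) fun k => (congR p k : Set _) := by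
  refine ((hasBasis_nhds_invLimR 1).comap (intToInvLim p)).congr (fun _ => Iff.rfl) fun k _ => ?_
  ext r
  exact QuotientGroup.eq_one_iff r

/-- `R` is dense in both groups, and both induce the topology with the `R(pᵏ)` as neighbourhood base
at 1. -/
theorem exists_invLimR_equiv_SLpm (p : ℕ) [Fact p.Prime] :
    ∃ θ : invLimR p ≃ₜ* SLpm ℤ_[p], ∀ r, θ (intToInvLim p r) = intToSLpm p r := by
  refine exists_continuousMulEquiv_of_denseRange (intToInvLim p) (intToSLpm p)
    denseRange_intToInvLim denseRange_intToSLpm ?_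
  rw [comap_nhds_one_codRestrict (σ := intToSLpm p)]
  exact comap_nhds_one_intToInvLim.eq_of_same_basis hasBasis_comap_intToZp

theorem pow_dvd_sub_of_invLimR_apply_eq [hp : Fact p.Prime] {θ : invLimR p ≃ₜ* SLpm ℤ_[p]}
    (hθ : ∀ r, θ (intToInvLim p r) = intToSLpm p r) (x : invLimR p) (n : ℕ) (r : GL (Fin 2) ℤ)
    (hx : x.1 n = QuotientGroup.mk r) (i j : Fin 2) :
    (p : ℤ_[p]) ^ n ∣ ((θ x : GL (Fin 2) ℤ_[p]) : Matrix (Fin 2) (Fin 2) ℤ_[p]) i j -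
      (((r : Matrix (Fin 2) (Fin 2) ℤ) i j : ℤ) : ℤ_[p]) := by
  have ho : IsOpen {y : invLimR p | y.1 n = QuotientGroup.mk r} :=
    have hc : Continuous fun y : invLimR p => y.1 n :=
      (continuous_apply n).comp continuous_subtype_val
    (isOpen_discrete {(QuotientGroup.mk r : QuotR p n)}).preimage hc
  have hT : IsClosed {y : invLimR p | (p : ℤ_[p]) ^ n ∣
      ((θ y : GL (Fin 2) ℤ_[p]) : Matrix (Fin 2) (Fin 2) ℤ_[p]) i j -
        (((r : Matrix (Fin 2) (Fin 2) ℤ) i j : ℤ) : ℤ_[p])} := by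
    simp only [← Ideal.mem_span_singleton, ← PadicInt.norm_le_pow_iff_mem_span_pow]
    exact isClosed_le (((Units.continuous_val.comp (continuous_subtype_val.comp
      θ.continuous)).matrix_elem i j).sub continuous_const).norm continuous_const
  -- The prescribed value at level `n` is an open condition and the congruence is a closed one, so
  -- by density it is enough to treat families coming from `R`.
  refine closure_minimal ?_ hT (denseRange_intToInvLim.open_subset_closure_inter ho hx)
  rintro _ ⟨hy, r', rfl⟩
  have hc : r⁻¹ * r' ∈ congR p n := QuotientGroup.eq.1 hy.symm
  have hd : (p : ℤ) ^ n ∣ ((r' : Matrix (Fin 2) (Fin 2) ℤ) - r) i j := by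
    have : (r' : Matrix (Fin 2) (Fin 2) ℤ) - r =
        r * (((r⁻¹ * r' : GL (Fin 2) ℤ) : Matrix (Fin 2) (Fin 2) ℤ) - 1) := by
      rw [mul_sub, mul_one, ← Units.val_mul, mul_inv_cancel_left]
    rw [this, Matrix.mul_apply]
    exact Finset.dvd_sum fun k _ => ((mem_congR p n _).1 hc k j).mul_left _
  rw [← PadicInt.pow_p_dvd_int_iff, Matrix.sub_apply, Int.cast_sub] at hd
  rw [Set.mem_ofPred_eq, hθ]
  exact hd

end InverseLimit

/-! ### The closures of `R` and `Q` in a completion -/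

section Closures

open Filter Topology

variable {p : ℕ} {L : Type*} [Group L] [TopologicalSpace L] [IsTopologicalGroup L] {σ : AffG p →* L} {K : Subgroup L}

theorem inQ_mem_barQ (q : GL (Fin 2) (ZInv p)) : σ (inQ p q) ∈ barQ σ :=
  Subgroup.le_topologicalClosure _ ⟨q, rfl⟩

theorem inQ_mem_barR {q : GL (Fin 2) (ZInv p)} (hq : q ∈ subR p) : σ (inQ p q) ∈ barR σ :=
  Subgroup.le_topologicalClosure _ ⟨q, hq, rfl⟩

/-- The closure of `R` is the intersection of the closure of `Q` with `K`. -/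
theorem barR_eq_inf (hK : IsSchlichtingCompletion (subH p) σ K) : barR σ = barQ σ ⊓ K := by
  apply le_antisymm
  · refine le_inf (Subgroup.topologicalClosure_mono ?_) (Subgroup.topologicalClosure_minimal _ ?_
      (K.isClosed_of_isOpen hK.pair.isOpen))
    · rintro _ ⟨q, -, rfl⟩
      exact ⟨q, rfl⟩
    · rintro _ ⟨q, hq, rfl⟩
      exact (hK.mem_iff _).2 ((inQ_mem_subH_iff q).2 hq)
  · rintro x ⟨hx, hxK⟩
    refine mem_closure_iff.2 fun V hV hxV => ?_
    obtain ⟨_, ⟨hyV, hyK⟩, q, rfl⟩ := mem_closure_iff.1 hx (V ∩ K) (hV.inter hK.pair.isOpen) ⟨hxV, hxK⟩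
    exact ⟨_, hyV, q, (inQ_mem_subH_iff q).1 ((hK.mem_iff _).1 hyK), rfl⟩

/-- The homomorphism from `Q` to its closure. -/
def qToBarQ (σ : AffG p →* L) : GL (Fin 2) (ZInv p) →* barQ σ :=
  (σ.comp (inQ p)).codRestrict _ inQ_mem_barQ

/-- The homomorphism from `R` to its closure. -/
def intToBarR (σ : AffG p →* L) : GL (Fin 2) ℤ →* barR σ :=
  ((σ.comp (inQ p)).comp (intToQ p)).codRestrict _ fun r => inQ_mem_barR ⟨r, rfl⟩

theorem denseRange_qToBarQ : DenseRange (qToBarQ σ) :=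
  denseRange_codRestrict_of_closure _ fun _ hx => hx

theorem denseRange_intToBarR : DenseRange (intToBarR σ) :=
  denseRange_codRestrict_of_closure _ fun x hx => by
    refine closure_mono ?_ hx
    rintro _ ⟨_, ⟨r, rfl⟩, rfl⟩
    exact ⟨r, rfl⟩

/-- For `x` in the closure of `Q`, the open coset `xK` contains some `σ q`. Then `σ(q)⁻¹ x` lies in
`K` and in the closure of `Q`, hence in the closure of `R`; changing `q` to its chosen
representative costs only an element of `R`. -/
theorem barQ_eq_iUnion (hK : IsSchlichtingCompletion (subH p) σ K)
    (s : GL (Fin 2) (ZInv p) ⧸ subR p → GL (Fin 2) (ZInv p))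
    (hs : ∀ c, (QuotientGroup.mk (s c) : GL (Fin 2) (ZInv p) ⧸ subR p) = c) :
    (barQ σ : Set L) = ⋃ c, σ (inQ p (s c)) • (barR σ : Set L) := by
  have hle : barR σ ≤ barQ σ := (barR_eq_inf hK).trans_le inf_le_left
  apply Set.Subset.antisymm
  · intro x hx
    obtain ⟨_, ⟨k, hk, hkq⟩, q, rfl⟩ := mem_closure_iff.1 hx _ (hK.pair.isOpen.leftCoset x)
      ⟨1, K.one_mem, by simp⟩
    refine Set.mem_iUnion.2 ⟨QuotientGroup.mk q, Set.mem_smul_set_iff_inv_smul_mem.2 ?_⟩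
    have h := QuotientGroup.eq.1 (hs (QuotientGroup.mk q))
    have h1 : (σ (inQ p q))⁻¹ * x ∈ barR σ := by
      rw [barR_eq_inf hK]
      refine ⟨(barQ σ).mul_mem ((barQ σ).inv_mem (inQ_mem_barQ q)) hx, ?_⟩
      have : (σ (inQ p q))⁻¹ * x = k⁻¹ := by
        have hkq : x * k = σ (inQ p q) := hkq
        rw [← hkq]
        group
      rw [this]
      exact K.inv_mem hk
    have h2 : (σ (inQ p (s (QuotientGroup.mk q))))⁻¹ * x =
        σ (inQ p ((s (QuotientGroup.mk q))⁻¹ * q)) * ((σ (inQ p q))⁻¹ * x) := by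
      simp [mul_assoc]
    rw [smul_eq_mul, SetLike.mem_coe, h2]
    exact (barR σ).mul_mem (inQ_mem_barR h) h1
  · refine Set.iUnion_subset fun c => ?_
    rintro _ ⟨x, hx, rfl⟩
    exact (barQ σ).mul_mem (inQ_mem_barQ _) (hle hx)

theorem isOpen_barR (hK : IsSchlichtingCompletion (subH p) σ K) :
    IsOpen {x : barQ σ | (x : L) ∈ barR σ} := by
  have : {x : barQ σ | (x : L) ∈ barR σ} = (↑) ⁻¹' (K : Set L) := by
    ext x
    change (x : L) ∈ barR σ ↔ (x : L) ∈ K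
    rw [barR_eq_inf hK]
    exact and_iff_right x.2
  rw [this]
  exact hK.pair.isOpen.preimage continuous_subtype_val

variable [hp : Fact p.Prime]

theorem comap_nhds_one_qToBarQ (hK : IsSchlichtingCompletion (subH p) σ K) :
    comap (qToBarQ σ) (𝓝 1) = comap (qToDetPM p) (𝓝 1) := by
  rw [comap_nhds_one_codRestrict, comap_nhds_one_codRestrict]
  exact hK.comap_nhds_one_inQ

/-- Both filters are the restriction to `R` of the `p`-adic topology of `Q`. -/
theorem comap_nhds_one_intToBarR (hK : IsSchlichtingCompletion (subH p) σ K) :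
    comap (intToBarR σ) (𝓝 1) = comap (intToInvLim p) (𝓝 1) := by
  have h : comap (intToInvLim p) (𝓝 1) = comap (intToSLpm p) (𝓝 1) := by
    rw [comap_nhds_one_codRestrict (σ := intToSLpm p)]
    exact comap_nhds_one_intToInvLim.eq_of_same_basis hasBasis_comap_intToZp
  rw [h, comap_nhds_one_intToSLpm, ← comap_nhds_one_qToBarQ hK, comap_nhds_one_codRestrict,
    comap_nhds_one_codRestrict, comap_comap]
  rfl

theorem exists_barR_barQ_equiv (hK : IsSchlichtingCompletion (subH p) σ K)
    {θ : invLimR p ≃ₜ* SLpm ℤ_[p]} (hθ : ∀ r, θ (intToInvLim p r) = intToSLpm p r) :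
    ∃ (α : barR σ ≃ₜ* invLimR p) (φ : barQ σ ≃ₜ* detPM p),
      (∀ r, α (intToBarR σ r) = intToInvLim p r) ∧ (∀ q, φ (qToBarQ σ q) = qToDetPM p q) ∧
      ∀ (x : barQ σ) (y : barR σ), (x : L) = y →
        (φ x : GL (Fin 2) ℚ_[p]) = zpToQp p (θ (α y)) := by
  have := hK.pair.hausdorff
  have := hK.pair.locallyCompact
  have hlR : LocallyCompactSpace (barR σ) :=
    (Subgroup.isClosed_topologicalClosure _).isClosedEmbedding_subtypeVal.locallyCompactSpace
  have hlQ : LocallyCompactSpace (barQ σ) :=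
    (Subgroup.isClosed_topologicalClosure _).isClosedEmbedding_subtypeVal.locallyCompactSpace
  obtain ⟨α, hα⟩ := exists_continuousMulEquiv_of_denseRange (intToBarR σ) (intToInvLim p)
    denseRange_intToBarR denseRange_intToInvLim (comap_nhds_one_intToBarR hK)
  obtain ⟨φ, hφ⟩ := exists_continuousMulEquiv_of_denseRange (qToBarQ σ) (qToDetPM p)
    denseRange_qToBarQ denseRange_qToDetPM (comap_nhds_one_qToBarQ hK)
  refine ⟨α, φ, hα, hφ, ?_⟩
  have hle : barR σ ≤ barQ σ := (barR_eq_inf hK).trans_le inf_le_left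
  -- Both sides are continuous in `y` and agree on the dense image of `R`.
  have key : ∀ y : barR σ, (φ ⟨y, hle y.2⟩ : GL (Fin 2) ℚ_[p]) = zpToQp p (θ (α y)) := by
    intro y
    refine denseRange_intToBarR.induction_on (p := fun y : barR σ =>
      (φ ⟨y, hle y.2⟩ : GL (Fin 2) ℚ_[p]) = zpToQp p (θ (α y))) y (isClosed_eq ?_ ?_) fun r => ?_
    · exact continuous_subtype_val.comp
        (φ.continuous.comp (continuous_subtype_val.subtype_mk _))
    · exact isOpenEmbedding_zpToQp.continuous.comp
        (continuous_subtype_val.comp (θ.continuous.comp α.continuous))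
    · rw [hα, hθ]
      exact (congrArg Subtype.val (hφ (intToQ p r))).trans (zpToQp_intToZp r).symm
  rintro ⟨_, hx⟩ y rfl
  exact key y

end Closures

/-! ### The main theorem -/

theorem theorem5p4 (p : ℕ) [Fact p.Prime] :
    -- the pair `(N ⋊ Q, M ⋊ R)` is a reduced Hecke pair
    IsHeckePair (subH p) ∧ IsReducedPair (subH p) ∧
    -- it has a Schlichting completion
    (∃ (L : Type) (_ : Group L) (_ : TopologicalSpace L) (_ : IsTopologicalGroup L)
      (σ : AffG p →* L) (K : Subgroup L), IsSchlichtingCompletion (subH p) σ K) ∧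
    -- `⋃ q SL_±(2, ℤ_p) = {g ∈ GL(2, ℚ_p) | det g ∈ ± p^ℤ}`, for representatives `q` of `Q / R`
    (∀ s : GL (Fin 2) (ZInv p) ⧸ subR p → GL (Fin 2) (ZInv p),
      (∀ c, (QuotientGroup.mk (s c) : GL (Fin 2) (ZInv p) ⧸ subR p) = c) →
      ⋃ c, qToQp p (s c) • (((SLpm ℤ_[p]).map (zpToQp p) : Subgroup (GL (Fin 2) ℚ_[p])) :
          Set (GL (Fin 2) ℚ_[p])) = (detPM p : Set (GL (Fin 2) ℚ_[p]))) ∧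
    -- the inverse limit of the `R / R(pⁿ)` is `SL_±(2, ℤ_p)`, by the canonical isomorphism `θ`
    ∃ θ : invLimR p ≃ₜ* SLpm ℤ_[p],
      (∀ (x : invLimR p) (n : ℕ) (r : GL (Fin 2) ℤ), x.1 n = QuotientGroup.mk r →
        ∀ i j, (p : ℤ_[p]) ^ n ∣
          ((θ x : GL (Fin 2) ℤ_[p]) : Matrix (Fin 2) (Fin 2) ℤ_[p]) i j -
            (((r : Matrix (Fin 2) (Fin 2) ℤ) i j : ℤ) : ℤ_[p])) ∧
      -- for every Schlichting completion
      ∀ (L : Type*) [Group L] [TopologicalSpace L] [IsTopologicalGroup L]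
        (σ : AffG p →* L) (K : Subgroup L), IsSchlichtingCompletion (subH p) σ K →
        -- the closure of `Q` is the union of the `q R̄`, and `R̄` is open in it
        (∀ s : GL (Fin 2) (ZInv p) ⧸ subR p → GL (Fin 2) (ZInv p),
          (∀ c, (QuotientGroup.mk (s c) : GL (Fin 2) (ZInv p) ⧸ subR p) = c) →
          (barQ σ : Set L) = ⋃ c, σ (inQ p (s c)) • (barR σ : Set L)) ∧
        IsOpen {x : barQ σ | (x : L) ∈ barR σ} ∧
        -- the canonical isomorphisms of topological groups
        ∃ (α : barR σ ≃ₜ* invLimR p) (φ : barQ σ ≃ₜ* detPM p),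
          (∀ (x : barR σ) (r : GL (Fin 2) ℤ), (x : L) = σ (inQ p (intToQ p r)) →
            ∀ n, (α x).1 n = QuotientGroup.mk r) ∧
          (∀ (x : barQ σ) (q : GL (Fin 2) (ZInv p)), (x : L) = σ (inQ p q) →
            (φ x : GL (Fin 2) ℚ_[p]) = qToQp p q) ∧
          (∀ (x : barQ σ) (y : barR σ), (x : L) = y →
            (φ x : GL (Fin 2) ℚ_[p]) = zpToQp p (θ (α y))) := by
  have hK := isSchlichtingCompletion_toClosureRange (p := p)
  obtain ⟨θ, hθ⟩ := exists_invLimR_equiv_SLpm p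
  refine ⟨?_, ?_, ⟨_, _, _, _, _, _, hK⟩, iUnion_smul_SLpm_eq, θ,
    pow_dvd_sub_of_invLimR_apply_eq hθ, ?_⟩
  · rw [hK.comap_eq]
    exact hK.pair.hecke.comap _
  · refine isReducedPair_iff.2 fun g hg => affToPadic_injective ?_
    -- Reducedness descends from the model because there conjugates by elements of `G` alone already
    -- have trivial intersection, and `G` embeds in it.
    have h1 := hK.eq_one_of_forall_conj_mem (l := toClosureRange (affToPadic p) g) fun x => by
      rw [← map_inv, ← map_mul, ← map_mul, hK.mem_iff]
      exact hg x
    exact (congrArg Subtype.val h1).trans (map_one _).symm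
  · intro L _ _ _ σ K hσ
    obtain ⟨α, φ, hα, hφ, hαφ⟩ := exists_barR_barQ_equiv hσ hθ
    refine ⟨barQ_eq_iUnion hσ, isOpen_barR hσ, α, φ, fun x r hx n => ?_, fun x q hx => ?_, hαφ⟩
    · obtain rfl : x = intToBarR σ r := Subtype.ext hx
      rw [hα, intToInvLim_apply]
    · obtain rfl : x = qToBarQ σ q := Subtype.ext hx
      rw [hφ]
      rfl
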